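/- Let $f:(M^m,g)\to(N^n,h)$ be a holomorphic map between Kähler manifolds (of complex dimensions $m$ and $n$), let $x_0\in M$ and $1\le \ell\le m$. Let $z=(z^1,\dots,z^m)$ and $w=(w^1,\dots,w^n)$ be holomorphic normal coordinates centered at $x_0$ and $f(x_0)$ (that is, $g_{\alpha\bar\beta}=\delta_{\alpha\beta}$, $dg_{\alpha\bar\beta}=0$ at $x_0$, and similarly for $h_{i\bar j}$ at $f(x_0)$) such that at $x_0$ $$\partial f\Big(\frac{\partial}{\partial z^\alpha}\Big)=\lambda_\alpha\,\delta^i_\alpha\,\frac{\partial}{\partial w^i},\qquad |\lambda_1|\ge\cdots\ge|\lambda_m|,$$ where $\lambda_\alpha\in\mathbb C$ and the $|\lambda_\alpha|$ are the singular values of $\partial f:T'_{x_0}M\to T'_{f(x_0)}N$ (so $\lambda_\alpha=0$ for $\alpha>n$). Near $x_0$ write $f^i_\alpha=\partial f^i/\partial z^\alpha$, $A_{\alpha\bar\beta}=\sum_{i,j} f^i_\alpha\overline{f^j_\beta}\,h_{i\bar j}$, and let $A_\ell$, $G_\ell$ be the upper left $\ell\times\ell$ blocks of $A=(A_{\alpha\bar\beta})$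 and $G=(g_{\alpha\bar\beta})$. With $g^{\alpha\bar\beta}$ the inverse of $g_{\alpha\bar\beta}$, put $$U_\ell=\sum_{1\le\alpha,\beta\le\ell}g^{\alpha\bar\beta}A_{\alpha\bar\beta},\qquad W_\ell=\frac{\det A_\ell}{\det G_\ell}.$$ The curvature of $g$ is $R^M_{\alpha\bar\beta\gamma\bar\delta}=-\sum_\epsilon g_{\epsilon\bar\beta}\,\partial_{\bar\delta}\Gamma^\epsilon_{\alpha\gamma}$ with $\Gamma^\epsilon_{\alpha\gamma}=\sum_\delta(\partial_\gamma g_{\alpha\bar\delta})g^{\bar\delta\epsilon}$, and similarly $R^N$ for $h$. For $v=\sum v^\gamma\partial/\partial z^\gamma\in T'_{x_0}M$ let $f^i_{\alpha v}=\sum_\gamma \frac{\partial^2 f^i}{\partial z^\alpha\partial z^\gamma}v^\gamma$ and $\langle\sqrt{-1}\partial\bar\partial u,\frac1{\sqrt{-1}}v\wedge\bar v\rangle=\sum_{\gamma,\delta} \frac{\partial^2u}{\partial z^\gamma\partial\bar z^\delta}v^\gamma\overline{v^\delta}$. In $R^M(\alpha,\bar\alpha,\cdot,\cdot)$ and $R^N(\alpha,\bar\alpha,\cdot,\cdot)$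 the index $\alpha$ stands for $\partial/\partial z^\alpha$ and $\partial/\partial w^\alpha$ respectively; terms with $\lambda_\alpha=0$ as a factor are $0$ when $\alpha>n$. Then at $x_0$, for every $v\in T'_{x_0}M$: (i) if $U_\ell(x_0)\ne0$, $$\Big\langle\sqrt{-1}\partial\bar\partial\log U_\ell,\tfrac1{\sqrt{-1}}v\wedge\bar v\Big\rangle=\frac{U_\ell\sum_{1\le i\le n,\,1\le\alpha\le\ell}|f^i_{\alpha v}|^2-\big|\sum_{\alpha=1}^\ell\overline{\lambda_\alpha}f^\alpha_{\alpha v}\big|^2}{U_\ell^2}+\sum_{\alpha=1}^\ell\frac{|\lambda_\alpha|^2}{U_\ell}\Big(-R^N(\alpha,\bar\alpha,\partial f(v),\overline{\partial f(v)})+R^M(\alpha,\bar\alpha,v,\bar v)\Big),$$ and the first term on the right is nonnegative; (ii) if $W_\ell(x_0)\ne0$, $$\Big\langle\sqrt{-1}\partial\bar\partial\log W_\ell,\tfrac1{\sqrt{-1}}v\wedge\bar v\Big\rangle=\sum_{\alpha=1}^\ell\ \sum_{\ell+1\le i\le n}\frac{|f^i_{\alpha v}|^2}{|\lambda_\alpha|^2}+\sum_{\alpha=1}^\ell\Big(-R^N(\alpha,\bar\alpha,\partial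 f(v),\overline{\partial f(v)})+R^M(\alpha,\bar\alpha,v,\bar v)\Big),$$ and the first term on the right is nonnegative. -/

import Mathlib

open scoped ContDiff Manifold ComplexConjugate

noncomputable section

/-- The complex Euclidean space on which complex `m`-manifolds are modelled. -/
abbrev CSpace (m : ℕ) : Type := EuclideanSpace ℂ (Fin m)

/-- The `a`-th vector of the standard basis. -/
def stdVec {m : ℕ} (a : Fin m) : CSpace m := EuclideanSpace.single a (1 : ℂ)

/-- Wirtinger derivative `∂u/∂z^a = (1/2) (∂u/∂x^a - √-1 ∂u/∂y^a)`. -/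
def dz {m : ℕ} (a : Fin m) (u : CSpace m → ℂ) (z : CSpace m) : ℂ :=
  (1 / 2 : ℂ) * (fderiv ℝ u z (stdVec a) - Complex.I * fderiv ℝ u z (Complex.I • stdVec a))

/-- Wirtinger derivative `∂u/∂z̄^a = (1/2) (∂u/∂x^a + √-1 ∂u/∂y^a)`. -/
def dzbar {m : ℕ} (a : Fin m) (u : CSpace m → ℂ) (z : CSpace m) : ℂ :=
  (1 / 2 : ℂ) * (fderiv ℝ u z (stdVec a) + Complex.I * fderiv ℝ u z (Complex.I • stdVec a))

section Manifold

variable {m : ℕ} {M : Type*} [TopologicalSpace M] [ChartedSpace (CSpace m) M]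

/-- The holomorphic charts of `M` (the charts of its maximal holomorphic atlas). -/
def IsHolChart (φ : OpenPartialHomeomorph M (CSpace m)) : Prop :=
  φ ∈ IsManifold.maximalAtlas 𝓘(ℂ, CSpace m) ω M

/-- The holomorphic tangent vector at `φ⁻¹(z)` with components `ξ` in the chart `φ`,
that is `∑ ξ^a ∂/∂z^a`. The holomorphic tangent space is the complex vector space
`TangentSpace 𝓘(ℂ, CSpace m) x`. -/
def vecOfCoords (φ : OpenPartialHomeomorph M (CSpace m)) (z ξ : CSpace m) :
    TangentSpace 𝓘(ℂ, CSpace m) (φ.symm z) :=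
  mfderiv 𝓘(ℂ, CSpace m) 𝓘(ℂ, CSpace m) φ.symm z ξ

/-- The components of a tangent vector at `x` in the chart `φ`. -/
def coordsOfVec (φ : OpenPartialHomeomorph M (CSpace m)) (x : M)
    (v : TangentSpace 𝓘(ℂ, CSpace m) x) : CSpace m :=
  mfderiv 𝓘(ℂ, CSpace m) 𝓘(ℂ, CSpace m) φ x v

end Manifold

/-- A Kähler metric on the complex manifold `M`: a smooth Hermitian metric whose Kähler form
is closed. `inner x u v` is `g(u, v̄)`. -/
structure KaehlerMetric (m : ℕ) (M : Type*) [TopologicalSpace M]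
    [ChartedSpace (CSpace m) M] where
  /-- The Hermitian product, linear in the first and conjugate linear in the second argument. -/
  inner : (x : M) → TangentSpace 𝓘(ℂ, CSpace m) x →ₗ[ℂ]
    TangentSpace 𝓘(ℂ, CSpace m) x →ₗ⋆[ℂ] ℂ
  symm' : ∀ (x : M) (u v : TangentSpace 𝓘(ℂ, CSpace m) x), inner x u v = conj (inner x v u)
  pos' : ∀ (x : M) (u : TangentSpace 𝓘(ℂ, CSpace m) x), u ≠ 0 → 0 < (inner x u u).re
  /-- The metric is smooth in every holomorphic chart. -/
  smooth' : ∀ φ : OpenPartialHomeomorph M (CSpace m), IsHolChart φ → ∀ ξ η : CSpace m,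
    ContDiffOn ℝ ∞ (fun z => inner (φ.symm z) (vecOfCoords φ z ξ) (vecOfCoords φ z η)) φ.target
  /-- `dω(ξ, η, ζ) = 0` in every holomorphic chart, for the constant real vector fields
  `ξ, η, ζ`, where `ω = √-1 ∑ g_{ab̄} dz^a ∧ dz̄^b` is the real form
  `ω(ξ, η) = -2 Im g(ξ, η̄)`. -/
  closed' : ∀ φ : OpenPartialHomeomorph M (CSpace m), IsHolChart φ → ∀ ξ η ζ : CSpace m,
    ∀ z ∈ φ.target,
      fderiv ℝ (fun y => -2 * (inner (φ.symm y) (vecOfCoords φ y η) (vecOfCoords φ y ζ)).im) z ξ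
      + fderiv ℝ (fun y => -2 * (inner (φ.symm y) (vecOfCoords φ y ζ) (vecOfCoords φ y ξ)).im) z η
      + fderiv ℝ (fun y => -2 * (inner (φ.symm y) (vecOfCoords φ y ξ) (vecOfCoords φ y η)).im) z ζ
      = 0

namespace KaehlerMetric

variable {m : ℕ} {M : Type*} [TopologicalSpace M] [ChartedSpace (CSpace m) M]

/-- The matrix `G(z) = (g_{ab̄}(z))`, `g_{ab̄} = g(∂/∂z^a, conj ∂/∂z^b)`, as a function of the
coordinates `z` of the chart `φ`. -/
def coeff (g : KaehlerMetric m M) (φ : OpenPartialHomeomorph M (CSpace m)) (z : CSpace m) :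
    Matrix (Fin m) (Fin m) ℂ :=
  Matrix.of fun a b => g.inner (φ.symm z) (vecOfCoords φ z (stdVec a)) (vecOfCoords φ z (stdVec b))

/-- The Christoffel symbols `Γ^b_{ac} = ∑_d (∂g_{ad̄}/∂z^c) g^{d̄b}`. -/
def christoffel (g : KaehlerMetric m M) (φ : OpenPartialHomeomorph M (CSpace m))
    (a c b : Fin m) (z : CSpace m) : ℂ :=
  ∑ d, dz c (fun y => g.coeff φ y a d) z * (g.coeff φ z)⁻¹ d b

/-- The components `R_{ab̄cd̄} = ∑_e g_{eb̄} R^e_{ad̄c}`, with `R^e_{ad̄c} = -∂Γ^e_{ac}/∂z̄^d`. -/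
def curvCoeff (g : KaehlerMetric m M) (φ : OpenPartialHomeomorph M (CSpace m))
    (a b c d : Fin m) (z : CSpace m) : ℂ :=
  ∑ e, g.coeff φ z e b * (-dzbar d (g.christoffel φ a c e) z)

/-- The curvature tensor `R(s, t̄, u, v̄) = ∑ R_{ab̄cd̄} s^a t̄^b u^c v̄^d` at `x`, computed in the
chart `φ`. -/
def curv (g : KaehlerMetric m M) (φ : OpenPartialHomeomorph M (CSpace m)) (x : M)
    (s t u v : TangentSpace 𝓘(ℂ, CSpace m) x) : ℂ :=
  ∑ a, ∑ b, ∑ c, ∑ d, g.curvCoeff φ a b c d (φ x) *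
    (coordsOfVec φ x s a * conj (coordsOfVec φ x t b) *
      coordsOfVec φ x u c * conj (coordsOfVec φ x v d))

/-- `φ` is a holomorphic normal coordinate system centered at `x₀`: there `g_{ab̄} = δ_{ab}` and
the first derivatives of `g_{ab̄}` vanish. -/
structure IsNormalChart (g : KaehlerMetric m M) (φ : OpenPartialHomeomorph M (CSpace m))
    (x₀ : M) : Prop where
  holChart : IsHolChart φ
  mem_source : x₀ ∈ φ.source
  centered : φ x₀ = 0
  unitary : g.coeff φ 0 = 1
  first_order : ∀ a b : Fin m, fderiv ℝ (fun z => g.coeff φ z a b) 0 = 0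

end KaehlerMetric

section Maps

variable {m n : ℕ} {M N : Type*} [TopologicalSpace M] [ChartedSpace (CSpace m) M]
  [TopologicalSpace N] [ChartedSpace (CSpace n) N]

/-- The `k`-th coordinate vector (counted from `0`) `∂/∂z^k` at the point `x` of the domain of the
chart `φ`; it is `0` if `k` is not smaller than the dimension. -/
def coordVec (φ : OpenPartialHomeomorph M (CSpace m)) (x : M) (k : ℕ) :
    TangentSpace 𝓘(ℂ, CSpace m) x :=
  if h : k < m then
    (mfderiv 𝓘(ℂ, CSpace m) 𝓘(ℂ, CSpace m) φ.symm (φ x) (stdVec ⟨k, h⟩) : CSpace m)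
  else (0 : CSpace m)

/-- The coordinate derivative `f^i_a = ∂f^i/∂z^a` as a function of the coordinates `z`. -/
def mapD (f : M → N) (φ : OpenPartialHomeomorph M (CSpace m))
    (ψ : OpenPartialHomeomorph N (CSpace n)) (i : Fin n) (a : Fin m) (z : CSpace m) : ℂ :=
  (fderiv ℂ (fun y => ψ (f (φ.symm y))) z (stdVec a)) i

/-- `f^i_{av} = ∑_c f^i_{ac} v^c` at `x`, with `f^i_{ac} = ∂²f^i/∂z^a∂z^c`. -/
def mapD2 (f : M → N) (φ : OpenPartialHomeomorph M (CSpace m))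
    (ψ : OpenPartialHomeomorph N (CSpace n)) (x : M) (i : Fin n) (a : Fin m)
    (v : TangentSpace 𝓘(ℂ, CSpace m) x) : ℂ :=
  ∑ c, fderiv ℂ (mapD f φ ψ i a) (φ x) (stdVec c) * coordsOfVec φ x v c

/-- The matrix `A = (A_{ab̄})`, `A_{ab̄} = ∑ f^i_a conj(f^j_b) h_{ij̄}`, of the pull-back of `h`. -/
def pullbackCoeff (h : KaehlerMetric n N) (f : M → N) (φ : OpenPartialHomeomorph M (CSpace m))
    (ψ : OpenPartialHomeomorph N (CSpace n)) (x : M) : Matrix (Fin m) (Fin m) ℂ :=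
  Matrix.of fun a b => ∑ i, ∑ j, mapD f φ ψ i a (φ x) * conj (mapD f φ ψ j b (φ x)) *
    h.coeff ψ (ψ (f x)) i j

/-- `U_ℓ = ∑_{a, b ≤ ℓ} g^{ab̄} A_{ab̄}`, where `∑_b g^{ab̄} g_{cb̄} = δ_{ac}`, so that `g^{ab̄}` is
the `(b, a)` entry of the inverse of the matrix `G`. The sum is real. -/
def Ufun (g : KaehlerMetric m M) (h : KaehlerMetric n N) (f : M → N)
    (φ : OpenPartialHomeomorph M (CSpace m)) (ψ : OpenPartialHomeomorph N (CSpace n))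
    {l : ℕ} (hl : l ≤ m) (x : M) : ℝ :=
  (∑ a : Fin l, ∑ b : Fin l, (g.coeff φ (φ x))⁻¹ (Fin.castLE hl b) (Fin.castLE hl a) *
    pullbackCoeff h f φ ψ x (Fin.castLE hl a) (Fin.castLE hl b)).re

/-- `W_ℓ = det A_ℓ / det G_ℓ` with the upper left `ℓ × ℓ` blocks of `A` and `G`. The two
determinants are real. -/
def Wfun (g : KaehlerMetric m M) (h : KaehlerMetric n N) (f : M → N)
    (φ : OpenPartialHomeomorph M (CSpace m)) (ψ : OpenPartialHomeomorph N (CSpace n))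
    {l : ℕ} (hl : l ≤ m) (x : M) : ℝ :=
  (((pullbackCoeff h f φ ψ x).submatrix (Fin.castLE hl) (Fin.castLE hl)).det /
    ((g.coeff φ (φ x)).submatrix (Fin.castLE hl) (Fin.castLE hl)).det).re

/-- `⟨√-1 ∂∂̄ u, (1/√-1) v ∧ v̄⟩ = ∑ (∂²u/∂z^c∂z̄^d) v^c conj(v^d)` at `x`, for a real function `u`,
computed in the chart `φ`. -/
def ddbar (φ : OpenPartialHomeomorph M (CSpace m)) (u : M → ℝ) (x : M)
    (v : TangentSpace 𝓘(ℂ, CSpace m) x) : ℂ :=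
  ∑ c, ∑ d, dz c (dzbar d (fun z => (u (φ.symm z) : ℂ))) (φ x) *
    (coordsOfVec φ x v c * conj (coordsOfVec φ x v d))

/-- `φ` and `ψ` are normal coordinates at `x₀` and `f(x₀)` that are adapted to the singular values
of `∂f`: `∂f(∂/∂z^a) = lam_a ∂/∂w^a` (the right side is `0` for `a > n`), the numbers `|lam_a|`
decrease and are the singular values of `∂f` at `x₀`, so `lam_a = 0` for `a > n`. -/
structure IsAdapted (g : KaehlerMetric m M) (h : KaehlerMetric n N) (f : M → N) (x₀ : M)
    (φ : OpenPartialHomeomorph M (CSpace m)) (ψ : OpenPartialHomeomorph N (CSpace n))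
    (lam : Fin m → ℂ) : Prop where
  normal_left : g.IsNormalChart φ x₀
  normal_right : h.IsNormalChart ψ (f x₀)
  diag : ∀ a : Fin m, mfderiv 𝓘(ℂ, CSpace m) 𝓘(ℂ, CSpace n) f x₀ (coordVec φ x₀ a) =
    lam a • coordVec ψ (f x₀) a
  antitone : Antitone fun a => ‖lam a‖
  eq_zero : ∀ a : Fin m, n ≤ (a : ℕ) → lam a = 0

/-- The gradient term in the formula for `log U_ℓ`:
`(U_ℓ ∑_{i ≤ n, a ≤ ℓ} |f^i_{av}|² - |∑_{a ≤ ℓ} conj(lam_a) f^a_{av}|²) / U_ℓ²`; the summands with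
`a > n`, where `lam_a = 0`, are absent from the second sum. -/
def gradU (g : KaehlerMetric m M) (h : KaehlerMetric n N) (f : M → N)
    (φ : OpenPartialHomeomorph M (CSpace m)) (ψ : OpenPartialHomeomorph N (CSpace n))
    (lam : Fin m → ℂ) {l : ℕ} (hl : l ≤ m) (x : M) (v : TangentSpace 𝓘(ℂ, CSpace m) x) : ℝ :=
  (Ufun g h f φ ψ hl x *
      (∑ i : Fin n, ∑ a : Fin l, ‖mapD2 f φ ψ x i (Fin.castLE hl a) v‖ ^ 2) -
    ‖∑ a : Fin l, if ha : (a : ℕ) < n then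
      conj (lam (Fin.castLE hl a)) * mapD2 f φ ψ x ⟨a, ha⟩ (Fin.castLE hl a) v else 0‖ ^ 2) /
    Ufun g h f φ ψ hl x ^ 2

/-- The gradient term `∑_{a ≤ ℓ} ∑_{ℓ < i ≤ n} |f^i_{av}|² / |lam_a|²` in the formula for
`log W_ℓ` (indices of `Fin n` start at `0`). -/
def gradW (f : M → N) (φ : OpenPartialHomeomorph M (CSpace m))
    (ψ : OpenPartialHomeomorph N (CSpace n))
    (lam : Fin m → ℂ) {l : ℕ} (hl : l ≤ m) (x : M) (v : TangentSpace 𝓘(ℂ, CSpace m) x) : ℝ :=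
  ∑ a : Fin l, ∑ i : Fin n, if l ≤ (i : ℕ) then
    ‖mapD2 f φ ψ x i (Fin.castLE hl a) v‖ ^ 2 / ‖lam (Fin.castLE hl a)‖ ^ 2 else 0

/-- `-R^N(a, ā, ∂f(v), conj ∂f(v)) + R^M(a, ā, v, v̄)` at `x`, for `a = ∂/∂w^a` and `a = ∂/∂z^a`
respectively. -/
def curvDiff (g : KaehlerMetric m M) (h : KaehlerMetric n N) (f : M → N)
    (φ : OpenPartialHomeomorph M (CSpace m)) (ψ : OpenPartialHomeomorph N (CSpace n))
    (x : M) (a : ℕ) (v : TangentSpace 𝓘(ℂ, CSpace m) x) : ℂ :=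
  -h.curv ψ (f x) (coordVec ψ (f x) a) (coordVec ψ (f x) a)
      (mfderiv 𝓘(ℂ, CSpace m) 𝓘(ℂ, CSpace n) f x v) (mfderiv 𝓘(ℂ, CSpace m) 𝓘(ℂ, CSpace n) f x v)
    + g.curv φ x (coordVec φ x a) (coordVec φ x a) v v

end Maps

end

noncomputable section

/-! Everything is a second-order computation at the common centre of two normal charts, tested on
one constant direction `V`, the components of `v`. There `G = 1`, `dG = 0` and `∂_V ∂̄_V g_{ab̄} =
-R^M(a, b̄, v, v̄)` (`curvCoeff_eq`), and likewise for `h`, whose derivatives are transported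
through the holomorphic coordinate expression of `f` (`levi_comp`).

Since the `f^i_a` are holomorphic, the matrix `A` has a simple 2-jet: `A = diag(|lam_a|²)`, `∂_V
A_{ab̄} = conj(lam_b) f^b_{av}`, and `∂_V ∂̄_V A_{aā} = ∑_i |f^i_{av}|² - |lam_a|² R^N(a, ā, ∂f(v),
conj ∂f(v))` (`levi_pullbackCoeff`). Both formulas follow by substituting this jet.

For `U`, the inverse metric contributes only through `∂_V ∂̄_V G⁻¹ = -∂_V ∂̄_V G` (`levi_inv`),
which yields `+R^M` with weight `|lam_a|²`. Then `∂∂̄ log r = (r ∂∂̄r - |∂r|²) / r²`, and the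
gradient term is nonnegative by Cauchy-Schwarz.

For `W`, Jacobi's formula gives `∂∂̄ log det B = tr(B⁻¹ ∂∂̄B) - tr(B⁻¹ ∂B B⁻¹ ∂̄B)`. At the diagonal
matrix `A_ℓ` the quadratic trace equals `∑_{a,b ≤ ℓ} |f^b_{av}|² / |lam_a|²`; it cancels the terms
`i ≤ ℓ` of the first trace and leaves a sum of squares. The factor `|lam_a|²` before `R^N` cancels
against `B⁻¹`. -/

/-- The complexified directional derivative `(1/2) (∂_V u + s ∂_{√-1 V} u)`: the Wirtinger
derivative `∂_V` for `s = -√-1`, and `∂̄_V` for `s = √-1`. -/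
def wirt {m : ℕ} (s : ℂ) (V : CSpace m) (u : CSpace m → ℂ) (z : CSpace m) : ℂ :=
  (1 / 2 : ℂ) * (fderiv ℝ u z V + s * fderiv ℝ u z (Complex.I • V))

/-- The Levi form `∂_V ∂̄_V u`. -/
def levi {m : ℕ} (V : CSpace m) (u : CSpace m → ℂ) (z : CSpace m) : ℂ :=
  wirt (-Complex.I) V (wirt Complex.I V u) z

/-! ### Wirtinger calculus and Levi forms along a fixed direction. -/

section Wirtinger

variable {m n : ℕ} {s t : ℂ} {V W z : CSpace m} {u w : CSpace m → ℂ}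

lemma dz_eq_wirt (a : Fin m) (u : CSpace m → ℂ) : dz a u = wirt (-Complex.I) (stdVec a) u := by
  funext z; simp only [dz, wirt]; ring

lemma dzbar_eq_wirt (a : Fin m) (u : CSpace m → ℂ) :
    dzbar a u = wirt Complex.I (stdVec a) u := rfl

lemma wirt_eq_zero (h : fderiv ℝ u z = 0) : wirt s V u z = 0 := by simp [wirt, h]

lemma wirt_const (c : ℂ) : wirt s V (fun _ => c) z = 0 := by simp [wirt]

lemma Filter.EventuallyEq.wirt_eq (h : u =ᶠ[nhds z] w) : wirt s V u z = wirt s V w z := by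
  simp only [wirt, h.fderiv_eq]

lemma Filter.EventuallyEq.wirt (h : u =ᶠ[nhds z] w) :
    _root_.wirt s V u =ᶠ[nhds z] _root_.wirt s V w := by
  filter_upwards [h.eventuallyEq_nhds] with y hy using hy.wirt_eq

lemma Filter.EventuallyEq.levi_eq (h : u =ᶠ[nhds z] w) : levi V u z = levi V w z :=
  (h.wirt).wirt_eq

lemma wirt_mul (hu : DifferentiableAt ℝ u z) (hw : DifferentiableAt ℝ w z) :
    wirt s V (fun y => u y * w y) z = wirt s V u z * w z + u z * wirt s V w z := by
  simp only [wirt, fderiv_fun_mul hu hw, _root_.add_apply,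
    _root_.smul_apply, smul_eq_mul]
  ring

lemma wirt_const_mul (c : ℂ) (hu : DifferentiableAt ℝ u z) :
    wirt s V (fun y => c * u y) z = c * wirt s V u z := by
  rw [wirt_mul (by fun_prop) hu, wirt_const]; ring

lemma wirt_add (hu : DifferentiableAt ℝ u z) (hw : DifferentiableAt ℝ w z) :
    wirt s V (fun y => u y + w y) z = wirt s V u z + wirt s V w z := by
  simp only [wirt, fderiv_fun_add hu hw, _root_.add_apply]
  ring

lemma wirt_sub (hu : DifferentiableAt ℝ u z) (hw : DifferentiableAt ℝ w z) :
    wirt s V (fun y => u y - w y) z = wirt s V u z - wirt s V w z := by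
  simp only [wirt, fderiv_fun_sub hu hw, _root_.sub_apply]
  ring

lemma wirt_sum {ι : Type*} (S : Finset ι) {u : ι → CSpace m → ℂ}
    (hu : ∀ i ∈ S, DifferentiableAt ℝ (u i) z) :
    wirt s V (fun y => ∑ i ∈ S, u i y) z = ∑ i ∈ S, wirt s V (u i) z := by
  simp only [wirt, fderiv_fun_sum hu, _root_.sum_apply, Finset.mul_sum,
    ← Finset.sum_add_distrib]

lemma wirt_prod {ι : Type*} [DecidableEq ι] (S : Finset ι) {u : ι → CSpace m → ℂ}
    (hu : ∀ i ∈ S, DifferentiableAt ℝ (u i) z) :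
    wirt s V (fun y => ∏ i ∈ S, u i y) z =
      ∑ i ∈ S, (∏ j ∈ S.erase i, u j z) * wirt s V (u i) z := by
  have h := (HasFDerivAt.finsetProd (u := S) fun i hi => (hu i hi).hasFDerivAt).fderiv
  simp only [wirt, h, _root_.sum_apply, _root_.smul_apply,
    smul_eq_mul, Finset.mul_sum, ← Finset.sum_add_distrib]
  exact Finset.sum_congr rfl fun i _ => by ring

lemma wirt_conj : wirt s V (fun y => conj (u y)) z = conj (wirt (conj s) V u z) := by
  have : fderiv ℝ (fun y => conj (u y)) z
      = (Complex.conjCLE : ℂ →L[ℝ] ℂ).comp (fderiv ℝ u z) :=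
    Complex.conjCLE.comp_fderiv
  simp only [wirt, this, ContinuousLinearMap.comp_apply, map_mul, map_add, Complex.conj_conj,
    ContinuousLinearEquiv.coe_coe, Complex.conjCLE_apply, map_div₀, map_one, map_ofNat]

lemma wirt_sum_dir {ι : Type*} (S : Finset ι) (V : ι → CSpace m) :
    wirt s (∑ i ∈ S, V i) u z = ∑ i ∈ S, wirt s (V i) u z := by
  simp only [wirt, map_sum, Finset.smul_sum, Finset.mul_sum, ← Finset.sum_add_distrib]

lemma map_complex_smul {E : Type*} [NormedAddCommGroup E] [NormedSpace ℝ E]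
    (L : CSpace m →L[ℝ] E) (c : ℂ) (V : CSpace m) :
    L (c • V) = c.re • L V + c.im • L (Complex.I • V) := by
  rw [← map_smul, ← map_smul, ← map_add]
  congr 1
  ext i
  simp only [PiLp.smul_apply, PiLp.add_apply, smul_eq_mul, Complex.real_smul]
  conv_lhs => rw [← Complex.re_add_im c]
  ring

/-- For `s = -√-1`, `wirt` is the complex linear part of the real differential, hence complex
homogeneous in the direction; for `s = √-1` it is the antilinear part. -/
lemma wirt_smul_dir (c : ℂ) :
    wirt (-Complex.I) (c • V) u z = c * wirt (-Complex.I) V u z := by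
  have h : Complex.I • c • V = (Complex.I * c) • V := smul_smul _ _ _
  simp only [wirt, h, map_complex_smul _ (Complex.I * c), map_complex_smul _ c, Complex.mul_re,
    Complex.mul_im, Complex.I_re, Complex.I_im, Complex.real_smul]
  conv_rhs => rw [← Complex.re_add_im c]
  push_cast
  linear_combination (c.im * fderiv ℝ u z (Complex.I • V) / 2 : ℂ) * Complex.I_sq

lemma wirt_smul_dir_bar (c : ℂ) :
    wirt Complex.I (c • V) u z = conj c * wirt Complex.I V u z := by
  have h : Complex.I • c • V = (Complex.I * c) • V := smul_smul _ _ _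
  have hc : conj c = c.re - c.im * Complex.I := by
    apply Complex.ext <;> simp
  simp only [wirt, h, map_complex_smul _ (Complex.I * c), map_complex_smul _ c, Complex.mul_re,
    Complex.mul_im, Complex.I_re, Complex.I_im, Complex.real_smul, hc]
  push_cast
  linear_combination (c.im * fderiv ℝ u z (Complex.I • V) / 2 : ℂ) * Complex.I_sq

lemma sum_smul_stdVec (V : CSpace m) : ∑ c, V c • stdVec c = V := by
  ext i
  simp [stdVec, Pi.single_apply]

lemma wirt_eq_sum_dz : wirt (-Complex.I) V u z = ∑ c, V c * dz c u z := by
  conv_lhs => rw [← sum_smul_stdVec V, wirt_sum_dir]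
  simp only [wirt_smul_dir, dz_eq_wirt]

lemma wirt_eq_sum_dzbar : wirt Complex.I V u z = ∑ c, conj (V c) * dzbar c u z := by
  conv_lhs => rw [← sum_smul_stdVec V, wirt_sum_dir]
  simp only [wirt_smul_dir_bar, dzbar_eq_wirt]

lemma ContDiffAt.wirt {k : WithTop ℕ∞} {l : WithTop ℕ∞} (hu : ContDiffAt ℝ k u z)
    (hl : l + 1 ≤ k) : ContDiffAt ℝ l (wirt s V u) z := by
  have h := hu.fderiv_right hl
  unfold _root_.wirt
  fun_prop

lemma ContDiffAt.differentiableAt_wirt (hu : ContDiffAt ℝ 2 u z) :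
    DifferentiableAt ℝ (_root_.wirt s V u) z :=
  (hu.wirt (l := 1) (by norm_num)).differentiableAt (by norm_num)

lemma ContDiffAt.eventually_differentiableAt {E : Type*} [NormedAddCommGroup E] [NormedSpace ℝ E]
    {u : CSpace m → E} (hu : ContDiffAt ℝ 2 u z) :
    ∀ᶠ y in nhds z, DifferentiableAt ℝ u y := by
  filter_upwards [hu.eventually (by decide)] with y hy using hy.differentiableAt (by norm_num)

/-- The direction is constant, so its components pass through both derivatives. This identifies
`levi` with the coordinate sum in `ddbar`. -/
lemma levi_eq_sum (hu : ContDiffAt ℝ 2 u z) :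
    levi V u z = ∑ c, ∑ d, dz c (dzbar d u) z * (V c * conj (V d)) := by
  have h : wirt Complex.I V u = fun y => ∑ d, conj (V d) * dzbar d u y := by
    funext y; exact wirt_eq_sum_dzbar
  have hd : ∀ d, DifferentiableAt ℝ (dzbar d u) z := fun d => hu.differentiableAt_wirt
  rw [levi, h, wirt_sum _ fun d _ => (hd d).const_mul _, Finset.sum_comm]
  refine Finset.sum_congr rfl fun d _ => ?_
  rw [wirt_const_mul _ (hd d), wirt_eq_sum_dz, Finset.mul_sum]
  exact Finset.sum_congr rfl fun c _ => by ring

lemma levi_mul (hu : ContDiffAt ℝ 2 u z) (hw : ContDiffAt ℝ 2 w z) :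
    levi V (fun y => u y * w y) z = levi V u z * w z +
      wirt Complex.I V u z * wirt (-Complex.I) V w z +
      wirt (-Complex.I) V u z * wirt Complex.I V w z + u z * levi V w z := by
  have h : wirt Complex.I V (fun y => u y * w y) =ᶠ[nhds z]
      fun y => wirt Complex.I V u y * w y + u y * wirt Complex.I V w y := by
    filter_upwards [hu.eventually_differentiableAt, hw.eventually_differentiableAt] with y h1 h2
      using wirt_mul h1 h2
  have du := hu.differentiableAt (by norm_num)
  have dw := hw.differentiableAt (by norm_num)
  have du' : DifferentiableAt ℝ (wirt Complex.I V u) z := hu.differentiableAt_wirt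
  have dw' : DifferentiableAt ℝ (wirt Complex.I V w) z := hw.differentiableAt_wirt
  rw [levi, h.wirt_eq, wirt_add (du'.fun_mul dw) (du.fun_mul dw'), wirt_mul du' dw, wirt_mul du dw',
    levi, levi]
  ring

lemma levi_sum {ι : Type*} (S : Finset ι) {u : ι → CSpace m → ℂ}
    (hu : ∀ i ∈ S, ContDiffAt ℝ 2 (u i) z) :
    levi V (fun y => ∑ i ∈ S, u i y) z = ∑ i ∈ S, levi V (u i) z := by
  have h : wirt Complex.I V (fun y => ∑ i ∈ S, u i y) =ᶠ[nhds z]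
      fun y => ∑ i ∈ S, wirt Complex.I V (u i) y := by
    have : ∀ᶠ y in nhds z, ∀ i ∈ S, DifferentiableAt ℝ (u i) y :=
      (Finset.eventually_all S).2 fun i hi => (hu i hi).eventually_differentiableAt
    filter_upwards [this] with y hy using wirt_sum S hy
  rw [levi, h.wirt_eq, wirt_sum S fun i hi => (hu i hi).differentiableAt_wirt]
  rfl

/-- Both sides expand into the same values of the second real differential, which is symmetric. -/
lemma wirt_comm (hu : ContDiffAt ℝ 2 u z) :
    wirt s V (wirt t W u) z = wirt t W (wirt s V u) z := by
  have hd : DifferentiableAt ℝ (fderiv ℝ u) z :=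
    (hu.fderiv_right (m := 1) (by norm_num)).differentiableAt (by norm_num)
  have key : ∀ (r : ℂ) (X Y : CSpace m), fderiv ℝ (wirt r X u) z Y =
      (1 / 2 : ℂ) * (fderiv ℝ (fderiv ℝ u) z Y X +
        r * fderiv ℝ (fderiv ℝ u) z Y (Complex.I • X)) := by
    intro r X Y
    have h1 : ∀ X' : CSpace m, HasFDerivAt (fun y => fderiv ℝ u y X')
        ((fderiv ℝ (fderiv ℝ u) z).flip X') z := fun X' => by
      simpa using hd.hasFDerivAt.clm_apply (hasFDerivAt_const X' z)
    have h2 : HasFDerivAt (wirt r X u) _ z :=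
      (((h1 X).add ((h1 (Complex.I • X)).const_mul r)).const_mul (1 / 2 : ℂ))
    rw [h2.fderiv]
    simp [mul_add]
  have hs : IsSymmSndFDerivAt ℝ u z := hu.isSymmSndFDerivAt (by simp)
  conv_lhs => rw [wirt]
  conv_rhs => rw [wirt]
  simp only [key]
  rw [hs V W, hs V (Complex.I • W), hs (Complex.I • V) W, hs (Complex.I • V) (Complex.I • W)]
  ring

/-- Conjugation exchanges `∂_V` and `∂̄_V`, and these commute. -/
lemma levi_conj (hu : ContDiffAt ℝ 2 u z) :
    levi V (fun y => conj (u y)) z = conj (levi V u z) := by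
  have h : wirt Complex.I V (fun y => conj (u y)) = fun y => conj (wirt (-Complex.I) V u y) := by
    funext y; rw [wirt_conj]; simp
  rw [levi, h, wirt_conj, levi, wirt_comm hu]
  simp

/-! ### Holomorphic functions and composition with holomorphic maps. -/

section Holomorphic

variable {F : CSpace m → CSpace n} {H : CSpace n → ℂ}

lemma DifferentiableAt.wirt_bar_eq_zero (hu : DifferentiableAt ℂ u z) :
    _root_.wirt Complex.I V u z = 0 := by
  rw [_root_.wirt, hu.fderiv_restrictScalars ℝ]
  simp only [ContinuousLinearMap.coe_restrictScalars', map_smul, smul_eq_mul]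
  linear_combination (fderiv ℂ u z V / 2 : ℂ) * Complex.I_sq

lemma DifferentiableAt.wirt_eq (hu : DifferentiableAt ℂ u z) :
    _root_.wirt (-Complex.I) V u z = fderiv ℂ u z V := by
  rw [_root_.wirt, hu.fderiv_restrictScalars ℝ]
  simp only [ContinuousLinearMap.coe_restrictScalars', map_smul, smul_eq_mul]
  linear_combination (-fderiv ℂ u z V / 2 : ℂ) * Complex.I_sq

lemma levi_eq_zero_of_holomorphic (hu : ∀ᶠ y in nhds z, DifferentiableAt ℂ u y) :
    levi V u z = 0 := by
  have h : wirt Complex.I V u =ᶠ[nhds z] fun _ => 0 := by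
    filter_upwards [hu] with y hy using hy.wirt_bar_eq_zero
  rw [levi, h.wirt_eq, wirt_const]

lemma wirt_comp (hH : DifferentiableAt ℝ H (F z)) (hF : DifferentiableAt ℂ F z) :
    wirt s V (fun y => H (F y)) z = wirt s (fderiv ℂ F z V) H (F z) := by
  have h : fderiv ℝ (fun y => H (F y)) z =
      (fderiv ℝ H (F z)).comp ((fderiv ℂ F z).restrictScalars ℝ) := by
    rw [← hF.fderiv_restrictScalars ℝ]
    exact fderiv_comp z hH (hF.restrictScalars ℝ)
  simp [wirt, h]

lemma levi_comp (hH : ContDiffAt ℝ 2 H (F z)) (hH0 : fderiv ℝ H (F z) = 0)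
    (hF : ContDiffAt ℂ 2 F z) :
    levi V (fun y => H (F y)) z = levi (fderiv ℂ F z V) H (F z) := by
  have hFe : ∀ᶠ y in nhds z, DifferentiableAt ℂ F y := by
    filter_upwards [hF.eventually (by decide)] with y hy using hy.differentiableAt (by norm_num)
  have hFz : DifferentiableAt ℂ F z := hF.differentiableAt (by norm_num)
  have h : wirt Complex.I V (fun y => H (F y)) =ᶠ[nhds z]
      fun y => ∑ d, conj (fderiv ℂ F y V d) * dzbar d H (F y) := by
    filter_upwards [hFz.continuousAt.eventually hH.eventually_differentiableAt, hFe]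
      with y h1 h2
    rw [wirt_comp h1 h2, wirt_eq_sum_dzbar]
  have hd : ∀ d, DifferentiableAt ℝ (dzbar d H) (F z) := fun d => hH.differentiableAt_wirt
  have hd' : ∀ d, DifferentiableAt ℝ (fun y => dzbar d H (F y)) z := fun d =>
    (hd d).comp z (hFz.restrictScalars ℝ)
  have hc : ∀ d, DifferentiableAt ℝ (fun y => conj (fderiv ℂ F y V d)) z := fun d => by
    have h1 : DifferentiableAt ℂ (fun y => fderiv ℂ F y V) z :=
      ((hF.fderiv_right (m := 1) (by norm_num)).differentiableAt (by norm_num)).clm_apply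
        (differentiableAt_const V)
    have h2 : DifferentiableAt ℂ (fun y => fderiv ℂ F y V d) z := by fun_prop
    exact Complex.conjCLE.differentiableAt.comp z (h2.restrictScalars ℝ)
  rw [levi, h.wirt_eq, wirt_sum _ fun d _ => (hc d).fun_mul (hd' d), levi_eq_sum hH, Finset.sum_comm]
  refine Finset.sum_congr rfl fun d _ => ?_
  -- The critical point hypothesis removes the term in which the derivative falls on `conj (fderiv ℂ
  -- F y V d)`. That factor is antiholomorphic, so only second derivatives of `H` survive in any
  -- case.
  have h0 : dzbar d H (F z) = 0 := wirt_eq_zero hH0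
  rw [wirt_mul (hc d) (hd' d), h0, mul_zero, zero_add, wirt_comp (hd d) hFz, wirt_eq_sum_dz,
    Finset.mul_sum]
  exact Finset.sum_congr rfl fun c _ => by ring

end Holomorphic

/-- `Real.log` is `log |·|`, so `r z ≠ 0` is enough and no sign has to be known. -/
lemma wirt_log {r : CSpace m → ℝ} (hr : DifferentiableAt ℝ (fun y => (r y : ℂ)) z) (h0 : r z ≠ 0) :
    wirt s V (fun y => (Real.log (r y) : ℂ)) z = wirt s V (fun y => (r y : ℂ)) z / r z := by
  have hr' : DifferentiableAt ℝ r z := by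
    simpa [Function.comp_def] using Complex.reCLM.differentiableAt.comp z hr
  have h1 : fderiv ℝ (fun y => (r y : ℂ)) z = Complex.ofRealCLM.comp (fderiv ℝ r z) :=
    (Complex.ofRealCLM.hasFDerivAt.comp z hr'.hasFDerivAt).fderiv
  have h2 : fderiv ℝ (fun y => (Real.log (r y) : ℂ)) z =
      Complex.ofRealCLM.comp ((r z)⁻¹ • fderiv ℝ r z) :=
    (Complex.ofRealCLM.hasFDerivAt.comp z (hr'.hasFDerivAt.log h0)).fderiv
  simp only [wirt, h1, h2, ContinuousLinearMap.comp_apply, _root_.smul_apply,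
    Complex.ofRealCLM_apply, smul_eq_mul]
  push_cast
  ring

lemma ContDiffAt.ofReal_log {r : CSpace m → ℝ} {k : WithTop ℕ∞}
    (hr : ContDiffAt ℝ k (fun y => (r y : ℂ)) z) (h0 : r z ≠ 0) :
    ContDiffAt ℝ k (fun y => (Real.log (r y) : ℂ)) z := by
  have hr' : ContDiffAt ℝ k r z := by
    simpa [Function.comp_def] using Complex.reCLM.contDiff.contDiffAt.comp z hr
  exact Complex.ofRealCLM.contDiff.contDiffAt.comp z (hr'.log h0)

end Wirtinger

/-! ### Derivatives of inverse matrices, determinants and `log det`. -/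

section MatrixCalculus

variable {m : ℕ} {ι : Type*} [Fintype ι] {s : ℂ} {V z : CSpace m}
  {B C : CSpace m → Matrix ι ι ℂ}

/-- The entrywise complexified directional derivative of a matrix-valued function. -/
def wirtM (s : ℂ) (V : CSpace m) (B : CSpace m → Matrix ι ι ℂ) (z : CSpace m) : Matrix ι ι ℂ :=
  Matrix.of fun i j => wirt s V (fun y => B y i j) z

/-- The entrywise Levi form of a matrix-valued function. -/
def leviM (V : CSpace m) (B : CSpace m → Matrix ι ι ℂ) (z : CSpace m) : Matrix ι ι ℂ :=
  Matrix.of fun i j => levi V (fun y => B y i j) z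

lemma wirtM_mul (hB : ∀ i j, DifferentiableAt ℝ (fun y => B y i j) z)
    (hC : ∀ i j, DifferentiableAt ℝ (fun y => C y i j) z) :
    wirtM s V (fun y => B y * C y) z = wirtM s V B z * C z + B z * wirtM s V C z := by
  ext i j
  simp only [wirtM, Matrix.of_apply, Matrix.mul_apply, Matrix.add_apply]
  rw [wirt_sum _ fun k _ => (hB i k).fun_mul (hC k j), ← Finset.sum_add_distrib]
  exact Finset.sum_congr rfl fun k _ => wirt_mul (hB i k) (hC k j)

variable [DecidableEq ι]

lemma contDiffAt_det {k : WithTop ℕ∞} (hB : ∀ i j, ContDiffAt ℝ k (fun y => B y i j) z) :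
    ContDiffAt ℝ k (fun y => (B y).det) z := by
  simp only [Matrix.det_apply']
  exact ContDiffAt.sum fun σ _ => contDiffAt_const.mul (contDiffAt_prod fun i _ => hB _ _)

lemma contDiffAt_matrix_inv {k : WithTop ℕ∞} (hB : ∀ i j, ContDiffAt ℝ k (fun y => B y i j) z)
    (h0 : (B z).det ≠ 0) (i j : ι) : ContDiffAt ℝ k (fun y => (B y)⁻¹ i j) z := by
  simp only [Matrix.inv_def, Ring.inverse_eq_inv', Matrix.smul_apply, smul_eq_mul,
    Matrix.adjugate_apply]
  refine ((contDiffAt_det hB).inv h0).mul (contDiffAt_det fun a b => ?_)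
  simp only [Matrix.updateRow_apply]
  split_ifs
  · exact contDiffAt_const
  · exact hB _ _

/-- Jacobi's formula: by multilinearity the derivative is the sum over the columns of the
determinant with that column differentiated, and Cramer's rule reads this sum as a trace with the
adjugate. -/
lemma wirt_det (hB : ∀ i j, DifferentiableAt ℝ (fun y => B y i j) z) :
    wirt s V (fun y => (B y).det) z = ((B z).adjugate * wirtM s V B z).trace := by
  have hp : ∀ σ : Equiv.Perm ι, DifferentiableAt ℝ (fun y => ∏ i, B y (σ i) i) z := fun σ =>
    (HasFDerivAt.finsetProd fun i _ => (hB _ _).hasFDerivAt).differentiableAt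
  have hcol : ((B z).adjugate * wirtM s V B z).trace =
      ∑ k, ((B z).updateCol k fun j => wirtM s V B z j k).det := by
    refine Finset.sum_congr rfl fun k _ => ?_
    rw [← Matrix.cramer_apply, Matrix.cramer_eq_adjugate_mulVec]
    rfl
  rw [hcol]
  simp only [Matrix.det_apply']
  rw [wirt_sum _ fun σ _ => (hp σ).const_mul _, Finset.sum_comm]
  refine Finset.sum_congr rfl fun σ _ => ?_
  rw [wirt_const_mul _ (hp σ), wirt_prod _ fun i _ => hB _ _, Finset.mul_sum]
  refine Finset.sum_congr rfl fun k _ => ?_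
  rw [← Finset.mul_prod_erase _ _ (Finset.mem_univ k), mul_comm (∏ j ∈ _, _)]
  congr 2
  · simp [wirtM]
  · refine Finset.prod_congr rfl fun j hj => ?_
    rw [Matrix.updateCol_ne (Finset.ne_of_mem_erase hj)]

lemma eventually_mul_inv_eq_one (hB : ∀ i j, ContDiffAt ℝ 1 (fun y => B y i j) z)
    (h0 : (B z).det ≠ 0) : ∀ᶠ y in nhds z, B y * (B y)⁻¹ = 1 := by
  filter_upwards [(contDiffAt_det hB).continuousAt.eventually_ne h0] with y hy
    using Matrix.mul_nonsing_inv _ (Ne.isUnit hy)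

/-- Differentiate `B * B⁻¹ = 1`, which holds near `z` because the determinant stays nonzero. -/
lemma wirtM_inv (hB : ∀ i j, ContDiffAt ℝ 1 (fun y => B y i j) z) (h0 : (B z).det ≠ 0) :
    wirtM s V (fun y => (B y)⁻¹) z = -((B z)⁻¹ * wirtM s V B z * (B z)⁻¹) := by
  have h1 : wirtM s V (fun y => B y * (B y)⁻¹) z = 0 := by
    ext i j
    have : (fun y => (B y * (B y)⁻¹) i j) =ᶠ[nhds z] fun _ => (1 : Matrix ι ι ℂ) i j := by
      filter_upwards [eventually_mul_inv_eq_one hB h0] with y hy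
      rw [hy]
    rw [wirtM, Matrix.of_apply, this.wirt_eq, wirt_const, Matrix.zero_apply]
  rw [wirtM_mul (fun i j => (hB i j).differentiableAt (by norm_num))
    (fun i j => (contDiffAt_matrix_inv hB h0 i j).differentiableAt (by norm_num))] at h1
  have h2 : (B z)⁻¹ * B z = 1 := Matrix.nonsing_inv_mul _ (Ne.isUnit h0)
  have h3 := congrArg (fun X => (B z)⁻¹ * X) h1
  simp only [mul_add, ← mul_assoc, h2, one_mul, mul_zero] at h3
  exact eq_neg_of_add_eq_zero_right h3

/-- Apply the Levi form to `B * B⁻¹ = 1`: the cross terms contain a first derivative of `B`, which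
vanishes, and both undifferentiated factors are the identity. -/
lemma levi_inv (hB : ∀ i j, ContDiffAt ℝ 2 (fun y => B y i j) z) (h1 : B z = 1)
    (hd : ∀ i j, fderiv ℝ (fun y => B y i j) z = 0) (i j : ι) :
    levi V (fun y => (B y)⁻¹ i j) z = - levi V (fun y => B y i j) z := by
  have h0 : (B z).det ≠ 0 := by simp [h1]
  have hI := contDiffAt_matrix_inv hB h0
  have h : (fun y => ∑ k, B y i k * (B y)⁻¹ k j) =ᶠ[nhds z]
      fun _ => (1 : Matrix ι ι ℂ) i j := by
    filter_upwards [eventually_mul_inv_eq_one (fun i j => (hB i j).of_le (by norm_num)) h0]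
      with y hy
    rw [← Matrix.mul_apply, hy]
  have h2 := h.levi_eq (V := V)
  rw [levi_eq_zero_of_holomorphic (.of_forall fun _ => differentiableAt_const _),
    levi_sum _ fun k _ => (hB i k).mul (hI k j)] at h2
  simp only [levi_mul (hB _ _) (hI _ _), wirt_eq_zero (hd _ _), h1, inv_one, zero_mul, add_zero,
    Matrix.one_apply, mul_ite, mul_one, mul_zero, ite_mul, one_mul, Finset.sum_add_distrib,
    Finset.sum_ite_eq, Finset.sum_ite_eq', Finset.mem_univ, if_true] at h2
  exact eq_neg_of_add_eq_zero_right h2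

/-- The value of `∂_V ∂̄_V log det B` given by Jacobi's formula. -/
def leviLogDet (V : CSpace m) (B : CSpace m → Matrix ι ι ℂ) (z : CSpace m) : ℂ :=
  ((B z)⁻¹ * leviM V B z).trace -
    ((B z)⁻¹ * wirtM (-Complex.I) V B z * (B z)⁻¹ * wirtM Complex.I V B z).trace

lemma wirt_trace_inv_mul (hB : ∀ i j, ContDiffAt ℝ 2 (fun y => B y i j) z) (h0 : (B z).det ≠ 0) :
    wirt (-Complex.I) V (fun y => ((B y)⁻¹ * wirtM Complex.I V B y).trace) z =
      leviLogDet V B z := by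
  have hB1 : ∀ i j, ContDiffAt ℝ 1 (fun y => B y i j) z := fun i j => (hB i j).of_le (by norm_num)
  have hI : ∀ i j, DifferentiableAt ℝ (fun y => (B y)⁻¹ i j) z := fun i j =>
    (contDiffAt_matrix_inv hB h0 i j).differentiableAt (by norm_num)
  have hQ : ∀ i j, DifferentiableAt ℝ (fun y => wirtM Complex.I V B y i j) z := fun i j =>
    (hB i j).differentiableAt_wirt
  have hm : ∀ i, DifferentiableAt ℝ (fun y => ((B y)⁻¹ * wirtM Complex.I V B y) i i) z := by
    intro i
    simp only [Matrix.mul_apply]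
    exact DifferentiableAt.fun_sum fun k _ => (hI i k).fun_mul (hQ k i)
  have h := wirtM_mul (s := -Complex.I) (V := V) hI hQ
  rw [wirtM_inv hB1 h0] at h
  have h2 : wirt (-Complex.I) V (fun y => ((B y)⁻¹ * wirtM Complex.I V B y).trace) z =
      (wirtM (-Complex.I) V (fun y => (B y)⁻¹ * wirtM Complex.I V B y) z).trace :=
    wirt_sum _ fun i _ => hm i
  have h3 : wirtM (-Complex.I) V (wirtM Complex.I V B) z = leviM V B z := rfl
  rw [h2, h, h3, Matrix.trace_add, leviLogDet, neg_mul, Matrix.trace_neg]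
  ring

lemma levi_log {r : CSpace m → ℝ} (hr : ContDiffAt ℝ 2 (fun y => (r y : ℂ)) z) (h0 : r z ≠ 0) :
    levi V (fun y => (Real.log (r y) : ℂ)) z =
      (r z * levi V (fun y => (r y : ℂ)) z - wirt (-Complex.I) V (fun y => (r y : ℂ)) z *
        wirt Complex.I V (fun y => (r y : ℂ)) z) / (r z : ℂ) ^ 2 := by
  have h0' : (r z : ℂ) ≠ 0 := by exact_mod_cast h0
  have hl := hr.ofReal_log h0
  -- Differentiating `r · ∂̄ log r = ∂̄ r` once more and solving for `∂∂̄ log r` avoids a quotient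
  -- rule.
  have h : (fun y => (r y : ℂ) * wirt Complex.I V (fun y => (Real.log (r y) : ℂ)) y) =ᶠ[nhds z]
      wirt Complex.I V (fun y => (r y : ℂ)) := by
    filter_upwards [hr.eventually_differentiableAt, hr.continuousAt.eventually_ne h0'] with y h1 h2
    have h2' : r y ≠ 0 := by exact_mod_cast h2
    rw [wirt_log h1 h2']
    field_simp
  have h2 := h.wirt_eq (s := -Complex.I) (V := V)
  rw [wirt_mul (hr.differentiableAt (by norm_num)) hl.differentiableAt_wirt,
    wirt_log (hr.differentiableAt (by norm_num)) h0] at h2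
  simp only [levi]
  rw [← h2]
  field_simp
  ring

/-- Near `z`, `∂̄ log r` is the difference of the traces `tr(B⁻¹ ∂̄B)` and `tr(C⁻¹ ∂̄C)`, whose
`∂_V` is known. Only the real quotient `r` is put under a logarithm, so no branch of the complex
logarithm is chosen. -/
lemma levi_log_det_div {r : CSpace m → ℝ} (hB : ∀ i j, ContDiffAt ℝ 2 (fun y => B y i j) z)
    (hC : ∀ i j, ContDiffAt ℝ 2 (fun y => C y i j) z) (hB0 : (B z).det ≠ 0)
    (hC0 : (C z).det ≠ 0) (hr : ∀ᶠ y in nhds z, (r y : ℂ) = (B y).det / (C y).det) :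
    levi V (fun y => (Real.log (r y) : ℂ)) z = leviLogDet V B z - leviLogDet V C z := by
  have trace_eq : ∀ {D : CSpace m → Matrix ι ι ℂ} {y : CSpace m},
      (∀ i j, DifferentiableAt ℝ (fun y => D y i j) y) → (D y).det ≠ 0 →
      ((D y)⁻¹ * wirtM Complex.I V D y).trace =
        wirt Complex.I V (fun y => (D y).det) y / (D y).det := by
    intro D y hD h0
    rw [wirt_det hD, Matrix.inv_def, Ring.inverse_eq_inv', Matrix.smul_mul, Matrix.trace_smul,
      smul_eq_mul, inv_mul_eq_div]
  have hdiff : ∀ {D : CSpace m → Matrix ι ι ℂ}, (∀ i j, ContDiffAt ℝ 2 (fun y => D y i j) z) →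
      ∀ᶠ y in nhds z, ∀ i j, DifferentiableAt ℝ (fun y => D y i j) y := fun hD =>
    Filter.eventually_all.2 fun i => Filter.eventually_all.2 fun j =>
      (hD i j).eventually_differentiableAt
  have hdet : ∀ {D : CSpace m → Matrix ι ι ℂ}, (∀ i j, ContDiffAt ℝ 2 (fun y => D y i j) z) →
      (D z).det ≠ 0 →
      DifferentiableAt ℝ (fun y => ((D y)⁻¹ * wirtM Complex.I V D y).trace) z := by
    intro D hD h0
    simp only [Matrix.trace, Matrix.diag, Matrix.mul_apply]
    exact DifferentiableAt.fun_sum fun i _ => DifferentiableAt.fun_sum fun k _ =>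
      ((contDiffAt_matrix_inv hD h0 i k).differentiableAt (by norm_num)).fun_mul
        ((hD k i).differentiableAt_wirt)
  have h : wirt Complex.I V (fun y => (Real.log (r y) : ℂ)) =ᶠ[nhds z] fun y =>
      ((B y)⁻¹ * wirtM Complex.I V B y).trace - ((C y)⁻¹ * wirtM Complex.I V C y).trace := by
    filter_upwards [hr.eventually_nhds, hdiff hB, hdiff hC,
      (contDiffAt_det hB).continuousAt.eventually_ne hB0,
      (contDiffAt_det hC).continuousAt.eventually_ne hC0,
      (contDiffAt_det hB).eventually_differentiableAt,
      (contDiffAt_det hC).eventually_differentiableAt] with y hry hBy hCy hB0 hC0 hdB hdC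
    have hrd : DifferentiableAt ℝ (fun y => (r y : ℂ)) y :=
      (hdB.fun_mul (hdC.fun_inv hC0)).congr_of_eventuallyEq
        (hry.mono fun x hx => hx.trans (div_eq_mul_inv _ _))
    have hr0 : (r y : ℂ) ≠ 0 := by
      rw [hry.self_of_nhds]; exact div_ne_zero hB0 hC0
    -- The product form `r · det C = det B` is the relation that gets differentiated; dividing by it
    -- afterwards gives logarithmic derivatives.
    have hprod : (fun y => (r y : ℂ) * (C y).det) =ᶠ[nhds y] fun y => (B y).det := by
      filter_upwards [hry, hdC.continuousAt.eventually_ne hC0] with x hx hx0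
      rw [hx, div_mul_cancel₀ _ hx0]
    have hp0 : (r y : ℂ) * (C y).det = (B y).det := hprod.eq_of_nhds
    have hp := hprod.wirt_eq (s := Complex.I) (V := V)
    rw [wirt_mul hrd hdC] at hp
    rw [wirt_log hrd (by exact_mod_cast hr0), trace_eq hBy hB0, trace_eq hCy hC0, ← hp, ← hp0]
    field_simp
    ring
  rw [levi, h.wirt_eq, wirt_sub (hdet hB hB0) (hdet hC hC0), wirt_trace_inv_mul hB hB0,
    wirt_trace_inv_mul hC hC0]

end MatrixCalculus

/-! ### The 2-jet of `∑ p_i conj(p_j) k_{ij}` for holomorphic `p` and critical `k`. -/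

section Sesquilinear

variable {m n : ℕ} {V z : CSpace m} {p q k : CSpace m → ℂ}

lemma ContDiffAt.conj {r : WithTop ℕ∞} (hq : ContDiffAt ℝ r q z) :
    ContDiffAt ℝ r (fun y => conj (q y)) z :=
  Complex.conjCLE.contDiff.contDiffAt.comp z hq

lemma wirt_bar_mul_conj_mul (hp : ContDiffAt ℂ 2 p z) (hq : ContDiffAt ℂ 2 q z)
    (hk : ContDiffAt ℝ 2 k z) (hk0 : fderiv ℝ k z = 0) :
    wirt Complex.I V (fun y => p y * conj (q y) * k y) z =
      p z * conj (fderiv ℂ q z V) * k z := by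
  have hp' := (hp.restrict_scalars ℝ).differentiableAt (by norm_num)
  have hq' := (hq.restrict_scalars ℝ).conj.differentiableAt (by norm_num)
  rw [wirt_mul (hp'.fun_mul hq') (hk.differentiableAt (by norm_num)), wirt_mul hp' hq',
    wirt_eq_zero hk0, wirt_conj, (hp.differentiableAt (by norm_num)).wirt_bar_eq_zero,
    Complex.conj_I, (hq.differentiableAt (by norm_num)).wirt_eq]
  ring

lemma wirt_mul_conj_mul (hp : ContDiffAt ℂ 2 p z) (hq : ContDiffAt ℂ 2 q z)
    (hk : ContDiffAt ℝ 2 k z) (hk0 : fderiv ℝ k z = 0) :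
    wirt (-Complex.I) V (fun y => p y * conj (q y) * k y) z =
      fderiv ℂ p z V * conj (q z) * k z := by
  have hp' := (hp.restrict_scalars ℝ).differentiableAt (by norm_num)
  have hq' := (hq.restrict_scalars ℝ).conj.differentiableAt (by norm_num)
  rw [wirt_mul (hp'.fun_mul hq') (hk.differentiableAt (by norm_num)), wirt_mul hp' hq',
    wirt_eq_zero hk0, wirt_conj, (hp.differentiableAt (by norm_num)).wirt_eq, map_neg,
    Complex.conj_I, neg_neg, (hq.differentiableAt (by norm_num)).wirt_bar_eq_zero, map_zero]
  ring

/-- `∂_V` sees only `p` and `∂̄_V` only `conj q`, so a single mixed product survives; every term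
with one derivative on `k` vanishes with `dk`. -/
lemma levi_mul_conj_mul (hp : ContDiffAt ℂ 2 p z) (hq : ContDiffAt ℂ 2 q z)
    (hk : ContDiffAt ℝ 2 k z) (hk0 : fderiv ℝ k z = 0) :
    levi V (fun y => p y * conj (q y) * k y) z =
      fderiv ℂ p z V * conj (fderiv ℂ q z V) * k z + p z * conj (q z) * levi V k z := by
  have hol : ∀ {u : CSpace m → ℂ}, ContDiffAt ℂ 2 u z → levi V u z = 0 := fun hu =>
    levi_eq_zero_of_holomorphic <| by
      filter_upwards [hu.eventually (by decide)] with y hy using hy.differentiableAt (by norm_num)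
  have hp' := hp.restrict_scalars ℝ
  have hq' := hq.restrict_scalars ℝ
  rw [levi_mul (hp'.mul hq'.conj) hk, levi_mul hp' hq'.conj, levi_conj hq', hol hp, hol hq,
    wirt_eq_zero hk0, wirt_eq_zero hk0, wirt_conj, wirt_conj,
    (hp.differentiableAt (by norm_num)).wirt_bar_eq_zero,
    (hp.differentiableAt (by norm_num)).wirt_eq, map_neg, Complex.conj_I, neg_neg,
    (hq.differentiableAt (by norm_num)).wirt_bar_eq_zero,
    (hq.differentiableAt (by norm_num)).wirt_eq, map_zero]
  ring

variable {p : Fin n → Fin m → CSpace m → ℂ} {k : Fin n → Fin n → CSpace m → ℂ}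

lemma contDiffAt_pullback (hp : ∀ i a, ContDiffAt ℂ 2 (p i a) z)
    (hk : ∀ i j, ContDiffAt ℝ 2 (k i j) z) (a b : Fin m) :
    ContDiffAt ℝ 2 (fun y => ∑ i, ∑ j, p i a y * conj (p j b y) * k i j y) z :=
  ContDiffAt.sum fun i _ => ContDiffAt.sum fun j _ =>
    (((hp i a).restrict_scalars ℝ).mul ((hp j b).restrict_scalars ℝ).conj).mul (hk i j)

lemma wirt_bar_pullback (hp : ∀ i a, ContDiffAt ℂ 2 (p i a) z)
    (hk : ∀ i j, ContDiffAt ℝ 2 (k i j) z) (hk0 : ∀ i j, fderiv ℝ (k i j) z = 0)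
    (hk1 : ∀ i j, k i j z = (1 : Matrix (Fin n) (Fin n) ℂ) i j) (a b : Fin m) :
    wirt Complex.I V (fun y => ∑ i, ∑ j, p i a y * conj (p j b y) * k i j y) z =
      ∑ i, p i a z * conj (fderiv ℂ (p i b) z V) := by
  have hd : ∀ i j, DifferentiableAt ℝ (fun y => p i a y * conj (p j b y) * k i j y) z := fun i j =>
    ((((hp i a).restrict_scalars ℝ).mul ((hp j b).restrict_scalars ℝ).conj).mul
      (hk i j)).differentiableAt (by norm_num)
  rw [wirt_sum _ fun i _ => DifferentiableAt.fun_sum fun j _ => hd i j]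
  refine Finset.sum_congr rfl fun i _ => ?_
  rw [wirt_sum _ fun j _ => hd i j]
  simp [wirt_bar_mul_conj_mul (hp _ _) (hp _ _) (hk _ _) (hk0 _ _), hk1, Matrix.one_apply]

lemma wirt_pullback (hp : ∀ i a, ContDiffAt ℂ 2 (p i a) z)
    (hk : ∀ i j, ContDiffAt ℝ 2 (k i j) z) (hk0 : ∀ i j, fderiv ℝ (k i j) z = 0)
    (hk1 : ∀ i j, k i j z = (1 : Matrix (Fin n) (Fin n) ℂ) i j) (a b : Fin m) :
    wirt (-Complex.I) V (fun y => ∑ i, ∑ j, p i a y * conj (p j b y) * k i j y) z =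
      ∑ i, fderiv ℂ (p i a) z V * conj (p i b z) := by
  have hd : ∀ i j, DifferentiableAt ℝ (fun y => p i a y * conj (p j b y) * k i j y) z := fun i j =>
    ((((hp i a).restrict_scalars ℝ).mul ((hp j b).restrict_scalars ℝ).conj).mul
      (hk i j)).differentiableAt (by norm_num)
  rw [wirt_sum _ fun i _ => DifferentiableAt.fun_sum fun j _ => hd i j]
  refine Finset.sum_congr rfl fun i _ => ?_
  rw [wirt_sum _ fun j _ => hd i j]
  simp [wirt_mul_conj_mul (hp _ _) (hp _ _) (hk _ _) (hk0 _ _), hk1, Matrix.one_apply]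

lemma levi_pullback (hp : ∀ i a, ContDiffAt ℂ 2 (p i a) z)
    (hk : ∀ i j, ContDiffAt ℝ 2 (k i j) z) (hk0 : ∀ i j, fderiv ℝ (k i j) z = 0)
    (hk1 : ∀ i j, k i j z = (1 : Matrix (Fin n) (Fin n) ℂ) i j) (a b : Fin m) :
    levi V (fun y => ∑ i, ∑ j, p i a y * conj (p j b y) * k i j y) z =
      ∑ i, fderiv ℂ (p i a) z V * conj (fderiv ℂ (p i b) z V) +
        ∑ i, ∑ j, p i a z * conj (p j b z) * levi V (k i j) z := by
  have hd : ∀ i j, ContDiffAt ℝ 2 (fun y => p i a y * conj (p j b y) * k i j y) z := fun i j =>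
    (((hp i a).restrict_scalars ℝ).mul ((hp j b).restrict_scalars ℝ).conj).mul (hk i j)
  rw [levi_sum _ fun i _ => ContDiffAt.sum fun j _ => hd i j, ← Finset.sum_add_distrib]
  refine Finset.sum_congr rfl fun i _ => ?_
  rw [levi_sum _ fun j _ => hd i j]
  simp [levi_mul_conj_mul (hp _ _) (hp _ _) (hk _ _) (hk0 _ _), hk1, Matrix.one_apply,
    Finset.sum_add_distrib]

end Sesquilinear

/-! ### Curvature at the centre of a normal chart. -/

namespace KaehlerMetric

variable {m : ℕ} {M : Type*} [TopologicalSpace M] [ChartedSpace (CSpace m) M]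
  {g : KaehlerMetric m M} {φ : OpenPartialHomeomorph M (CSpace m)} {x₀ : M}

lemma coeff_isHermitian (g : KaehlerMetric m M) (φ : OpenPartialHomeomorph M (CSpace m))
    (z : CSpace m) : (g.coeff φ z).IsHermitian := by
  ext a b
  simp only [coeff, Matrix.conjTranspose_apply, Matrix.of_apply]
  exact (g.symm' _ _ _).symm

lemma contDiffAt_coeff (g : KaehlerMetric m M) (hφ : IsHolChart φ) {z : CSpace m}
    (hz : z ∈ φ.target) {k : WithTop ℕ∞} (hk : k ≤ ∞) (a b : Fin m) :
    ContDiffAt ℝ k (fun y => g.coeff φ y a b) z :=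
  ((g.smooth' φ hφ (stdVec a) (stdVec b)).contDiffAt (φ.open_target.mem_nhds hz)).of_le hk

namespace IsNormalChart

lemma zero_mem_target (hg : g.IsNormalChart φ x₀) : (0 : CSpace m) ∈ φ.target :=
  hg.centered ▸ φ.map_source hg.mem_source

lemma contDiffAt_coeff (hg : g.IsNormalChart φ x₀) {k : WithTop ℕ∞} (hk : k ≤ ∞) (a b : Fin m) :
    ContDiffAt ℝ k (fun y => g.coeff φ y a b) 0 :=
  g.contDiffAt_coeff hg.holChart hg.zero_mem_target hk a b

lemma contDiffAt_coeff_two (hg : g.IsNormalChart φ x₀) (a b : Fin m) :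
    ContDiffAt ℝ 2 (fun y => g.coeff φ y a b) 0 :=
  hg.contDiffAt_coeff (WithTop.coe_le_coe.2 (le_top : (2 : ℕ∞) ≤ ⊤)) a b

/-- In `∂̄Γ`, a derivative falling on the inverse metric is multiplied by a first derivative of the
metric, which is zero at the centre; the remaining factors of the metric and its inverse are
identities. -/
lemma curvCoeff_eq (hg : g.IsNormalChart φ x₀) (a b c d : Fin m) :
    g.curvCoeff φ a b c d 0 = - dz c (dzbar d fun y => g.coeff φ y a b) 0 := by
  have hC := hg.contDiffAt_coeff_two
  have hdet : (g.coeff φ 0).det ≠ 0 := by simp [hg.unitary]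
  have hI : ∀ i j, DifferentiableAt ℝ (fun y => (g.coeff φ y)⁻¹ i j) 0 := fun i j =>
    (contDiffAt_matrix_inv hC hdet i j).differentiableAt (by norm_num)
  have hD : ∀ i j, DifferentiableAt ℝ (dz c fun y => g.coeff φ y i j) 0 := fun i j => by
    rw [dz_eq_wirt]; exact (hC i j).differentiableAt_wirt
  have h0 : ∀ i j, dz c (fun y => g.coeff φ y i j) 0 = 0 := fun i j => by
    rw [dz_eq_wirt]; exact wirt_eq_zero (hg.first_order i j)
  have hG : ∀ e, dzbar d (g.christoffel φ a c e) 0 =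
      dzbar d (dz c fun y => g.coeff φ y a e) 0 := by
    intro e
    have h : g.christoffel φ a c e = fun y => ∑ k, dz c (fun y => g.coeff φ y a k) y *
      (g.coeff φ y)⁻¹ k e := rfl
    rw [dzbar_eq_wirt, h, wirt_sum _ fun k _ => (hD a k).fun_mul (hI k e)]
    simp [wirt_mul (hD _ _) (hI _ _), h0, hg.unitary, Matrix.one_apply, dzbar_eq_wirt]
  have hcomm : dzbar d (dz c fun y => g.coeff φ y a b) 0 =
      dz c (dzbar d fun y => g.coeff φ y a b) 0 := by
    rw [dz_eq_wirt, dzbar_eq_wirt, dz_eq_wirt, dzbar_eq_wirt, wirt_comm (hC a b)]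
  simp [curvCoeff, hG, hg.unitary, Matrix.one_apply, hcomm]

end IsNormalChart
end KaehlerMetric

/-! ### Tangent vectors and maps in holomorphic charts. -/

section Charts

variable {m n : ℕ} {M N : Type*} [TopologicalSpace M] [ChartedSpace (CSpace m) M]
  [TopologicalSpace N] [ChartedSpace (CSpace n) N]
  {φ : OpenPartialHomeomorph M (CSpace m)} {ψ : OpenPartialHomeomorph N (CSpace n)}
  {f : M → N} {x : M}

lemma IsHolChart.mdifferentiable [IsManifold 𝓘(ℂ, CSpace m) ω M] (hφ : IsHolChart φ) :
    φ.MDifferentiable 𝓘(ℂ, CSpace m) 𝓘(ℂ, CSpace m) :=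
  ⟨(contMDiffOn_of_mem_maximalAtlas hφ).mdifferentiableOn (by simp),
    (contMDiffOn_symm_of_mem_maximalAtlas hφ).mdifferentiableOn (by simp)⟩

lemma coordsOfVec_mfderiv_symm [IsManifold 𝓘(ℂ, CSpace m) ω M] (hφ : IsHolChart φ)
    (hx : x ∈ φ.source) (ξ : CSpace m) :
    coordsOfVec φ x (mfderiv 𝓘(ℂ, CSpace m) 𝓘(ℂ, CSpace m) φ.symm (φ x) ξ : CSpace m) = ξ := by
  -- The vector `mfderiv … φ.symm (φ x) ξ` lives over `φ.symm (φ x)`, which equals `x` only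
  -- propositionally. Generalizing the base point permits the transport.
  have key : ∀ y, y = x → coordsOfVec φ y
      (mfderiv 𝓘(ℂ, CSpace m) 𝓘(ℂ, CSpace m) φ.symm (φ x) ξ : CSpace m) = ξ →
      coordsOfVec φ x
        (mfderiv 𝓘(ℂ, CSpace m) 𝓘(ℂ, CSpace m) φ.symm (φ x) ξ : CSpace m) = ξ := by
    rintro y rfl h; exact h
  exact key _ (φ.left_inv hx)
    (DFunLike.congr_fun (hφ.mdifferentiable.comp_symm_deriv (φ.map_source hx)) ξ)

lemma coordsOfVec_coordVec [IsManifold 𝓘(ℂ, CSpace m) ω M] (hφ : IsHolChart φ)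
    (hx : x ∈ φ.source) (k : ℕ) :
    coordsOfVec φ x (coordVec φ x k) = if h : k < m then stdVec ⟨k, h⟩ else 0 := by
  split_ifs with h
  · have hk : coordVec φ x k =
        (mfderiv 𝓘(ℂ, CSpace m) 𝓘(ℂ, CSpace m) φ.symm (φ x) (stdVec ⟨k, h⟩) : CSpace m) := dif_pos h
    rw [hk]
    exact coordsOfVec_mfderiv_symm hφ hx _
  · have hk : coordVec φ x k = (0 : CSpace m) := dif_neg h
    rw [hk]
    exact map_zero (mfderiv 𝓘(ℂ, CSpace m) 𝓘(ℂ, CSpace m) φ x)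

lemma contDiffAt_coordMap [IsManifold 𝓘(ℂ, CSpace m) ω M] [IsManifold 𝓘(ℂ, CSpace n) ω N]
    (hf : ContMDiff 𝓘(ℂ, CSpace m) 𝓘(ℂ, CSpace n) ω f) (hφ : IsHolChart φ) (hψ : IsHolChart ψ)
    (hx : x ∈ φ.source) (hfx : f x ∈ ψ.source) :
    ContDiffAt ℂ ω (fun y => ψ (f (φ.symm y))) (φ x) := by
  have h1 : ContMDiffAt 𝓘(ℂ, CSpace m) 𝓘(ℂ, CSpace m) ω φ.symm (φ x) :=
    contMDiffAt_symm_of_mem_maximalAtlas hφ (φ.map_source hx)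
  have hx' := φ.left_inv hx
  have h2 : ContMDiffAt 𝓘(ℂ, CSpace n) 𝓘(ℂ, CSpace n) ω ψ (f (φ.symm (φ x))) :=
    contMDiffAt_of_mem_maximalAtlas hψ (by rwa [hx'])
  exact (h2.comp (φ x) (hf.contMDiffAt.comp (φ x) h1)).contDiffAt

/-- Both sides are the differential at `x` of `ψ ∘ f`, since `φ.symm ∘ φ` is the identity near `x`;
the differential is unique. -/
lemma fderiv_coordMap [IsManifold 𝓘(ℂ, CSpace m) ω M] [IsManifold 𝓘(ℂ, CSpace n) ω N]
    (hf : ContMDiff 𝓘(ℂ, CSpace m) 𝓘(ℂ, CSpace n) ω f) (hφ : IsHolChart φ) (hψ : IsHolChart ψ)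
    (hx : x ∈ φ.source) (hfx : f x ∈ ψ.source) (v : TangentSpace 𝓘(ℂ, CSpace m) x) :
    fderiv ℂ (fun y => ψ (f (φ.symm y))) (φ x) (coordsOfVec φ x v) =
      coordsOfVec ψ (f x) (mfderiv 𝓘(ℂ, CSpace m) 𝓘(ℂ, CSpace n) f x v) := by
  have hF : DifferentiableAt ℂ (fun y => ψ (f (φ.symm y))) (φ x) :=
    (contDiffAt_coordMap hf hφ hψ hx hfx).differentiableAt (by simp)
  have h1 : HasMFDerivAt 𝓘(ℂ, CSpace m) 𝓘(ℂ, CSpace n) (fun x => ψ (f (φ.symm (φ x)))) x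
      ((fderiv ℂ (fun y => ψ (f (φ.symm y))) (φ x)).comp
        (mfderiv 𝓘(ℂ, CSpace m) 𝓘(ℂ, CSpace m) φ x)) :=
    HasMFDerivAt.comp (g := fun y => ψ (f (φ.symm y))) (f := φ) x hF.hasFDerivAt.hasMFDerivAt
      (hφ.mdifferentiable.mdifferentiableAt hx).hasMFDerivAt
  have h2 : HasMFDerivAt 𝓘(ℂ, CSpace m) 𝓘(ℂ, CSpace n) (fun x => ψ (f x)) x
      ((mfderiv 𝓘(ℂ, CSpace n) 𝓘(ℂ, CSpace n) ψ (f x)).comp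
        (mfderiv 𝓘(ℂ, CSpace m) 𝓘(ℂ, CSpace n) f x)) :=
    HasMFDerivAt.comp (g := ψ) (f := f) x (hψ.mdifferentiable.mdifferentiableAt hfx).hasMFDerivAt
      ((hf.mdifferentiable (by simp)) x).hasMFDerivAt
  have h3 : (fun x => ψ (f (φ.symm (φ x)))) =ᶠ[nhds x] fun x => ψ (f x) := by
    filter_upwards [φ.open_source.mem_nhds hx] with y hy
    rw [φ.left_inv hy]
  exact DFunLike.congr_fun (hasMFDerivAt_unique h1 (h2.congr_of_eventuallyEq h3)) v

lemma KaehlerMetric.IsNormalChart.curv_coordVec [IsManifold 𝓘(ℂ, CSpace m) ω M]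
    {g : KaehlerMetric m M} (hg : g.IsNormalChart φ x) (k : ℕ)
    (v : TangentSpace 𝓘(ℂ, CSpace m) x) :
    g.curv φ x (coordVec φ x k) (coordVec φ x k) v v =
      if h : k < m then
        - levi (coordsOfVec φ x v) (fun y => g.coeff φ y ⟨k, h⟩ ⟨k, h⟩) 0 else 0 := by
  rw [curv, coordsOfVec_coordVec hg.holChart hg.mem_source, hg.centered]
  split_ifs with h
  · rw [levi_eq_sum (hg.contDiffAt_coeff_two _ _), Finset.sum_eq_single ⟨k, h⟩,
      Finset.sum_eq_single ⟨k, h⟩]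
    · simp [hg.curvCoeff_eq, stdVec]
    · intro b _ hb; simp [stdVec, hb]
    · simp
    · intro b _ hb; simp [stdVec, hb]
    · simp
  · simp

end Charts

/-- Source and target indices lie in different types `Fin m` and `Fin n` and can be matched only as
natural numbers; an index beyond `n` contributes `0`. -/
lemma Fin.sum_ite_val_eq {n : ℕ} {R : Type*} [AddCommMonoid R] (k : ℕ) (c : Fin n → R) :
    (∑ i : Fin n, if (i : ℕ) = k then c i else 0) = if h : k < n then c ⟨k, h⟩ else 0 := by
  split_ifs with h
  · rw [Finset.sum_eq_single ⟨k, h⟩]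
    · simp
    · intro i _ hi
      exact if_neg fun h' => hi (Fin.ext h')
    · simp
  · exact Finset.sum_eq_zero fun i _ => if_neg fun h' : (i : ℕ) = k => h (h' ▸ i.2)

lemma Fin.sum_eq_sum_ite_add_sum_castLE {l n : ℕ} {R : Type*} [AddCommMonoid R] (hl : l ≤ n)
    (c : Fin n → R) :
    ∑ i, c i = (∑ i : Fin n, if l ≤ (i : ℕ) then c i else 0) +
      ∑ b : Fin l, c (Fin.castLE hl b) := by
  obtain ⟨k, rfl⟩ := Nat.exists_eq_add_of_le hl
  rw [Fin.sum_univ_add, Fin.sum_univ_add, add_comm]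
  congr 1
  rw [Finset.sum_eq_zero (fun i _ => if_neg (by simp)), zero_add]
  exact Finset.sum_congr rfl fun i _ => by simp

/-! ### Reality of `U` and `W`, and the 2-jet of the pull-back matrix at the centre. -/

section Adapted

variable {m n : ℕ} {M N : Type*} [TopologicalSpace M] [ChartedSpace (CSpace m) M]
  [TopologicalSpace N] [ChartedSpace (CSpace n) N]
  {g : KaehlerMetric m M} {h : KaehlerMetric n N} {f : M → N} {x₀ : M}
  {φ : OpenPartialHomeomorph M (CSpace m)} {ψ : OpenPartialHomeomorph N (CSpace n)}
  {lam : Fin m → ℂ} {l : ℕ}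

omit [ChartedSpace (CSpace m) M] in
lemma pullbackCoeff_isHermitian (h : KaehlerMetric n N) (f : M → N)
    (φ : OpenPartialHomeomorph M (CSpace m)) (ψ : OpenPartialHomeomorph N (CSpace n)) (x : M) :
    (pullbackCoeff h f φ ψ x).IsHermitian := by
  ext a b
  simp only [pullbackCoeff, Matrix.conjTranspose_apply, Matrix.of_apply, star_sum]
  rw [Finset.sum_comm]
  refine Finset.sum_congr rfl fun i _ => Finset.sum_congr rfl fun j _ => ?_
  have := (h.coeff_isHermitian ψ (ψ (f x))).apply i j
  rw [← this]
  simp only [star_mul', RCLike.star_def, Complex.conj_conj]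
  ring

/-- Conjugating and exchanging the two summation indices fixes the sum, because `G⁻¹` and `A` are
Hermitian. Hence taking the real part in `Ufun` loses nothing. -/
lemma ofReal_Ufun (g : KaehlerMetric m M) (h : KaehlerMetric n N) (f : M → N)
    (φ : OpenPartialHomeomorph M (CSpace m)) (ψ : OpenPartialHomeomorph N (CSpace n))
    (hl : l ≤ m) (x : M) :
    (Ufun g h f φ ψ hl x : ℂ) = ∑ a : Fin l, ∑ b : Fin l,
      (g.coeff φ (φ x))⁻¹ (Fin.castLE hl b) (Fin.castLE hl a) *
        pullbackCoeff h f φ ψ x (Fin.castLE hl a) (Fin.castLE hl b) := by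
  rw [Ufun, ← Complex.conj_eq_iff_re, map_sum, Finset.sum_comm]
  simp only [map_sum, map_mul]
  refine Finset.sum_congr rfl fun a _ => Finset.sum_congr rfl fun b _ => ?_
  have h1 := (g.coeff_isHermitian φ (φ x)).inv.apply (Fin.castLE hl b) (Fin.castLE hl a)
  have h2 := (pullbackCoeff_isHermitian h f φ ψ x).apply (Fin.castLE hl a) (Fin.castLE hl b)
  rw [← h1, ← h2]
  simp

lemma ofReal_Wfun (g : KaehlerMetric m M) (h : KaehlerMetric n N) (f : M → N)
    (φ : OpenPartialHomeomorph M (CSpace m)) (ψ : OpenPartialHomeomorph N (CSpace n))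
    (hl : l ≤ m) (x : M) :
    (Wfun g h f φ ψ hl x : ℂ) =
      ((pullbackCoeff h f φ ψ x).submatrix (Fin.castLE hl) (Fin.castLE hl)).det /
        ((g.coeff φ (φ x)).submatrix (Fin.castLE hl) (Fin.castLE hl)).det := by
  have key : ∀ {D : Matrix (Fin m) (Fin m) ℂ}, D.IsHermitian →
      conj (D.submatrix (Fin.castLE hl) (Fin.castLE hl)).det =
        (D.submatrix (Fin.castLE hl) (Fin.castLE hl)).det := by
    intro D hD
    have h1 := Matrix.det_conjTranspose (D.submatrix (Fin.castLE hl) (Fin.castLE hl))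
    rw [(hD.submatrix _).eq] at h1
    exact h1.symm
  rw [Wfun, ← Complex.conj_eq_iff_re, map_div₀, key (pullbackCoeff_isHermitian h f φ ψ x),
    key (g.coeff_isHermitian φ (φ x))]

lemma ddbar_eq_levi {u : M → ℝ} {x : M} {v : TangentSpace 𝓘(ℂ, CSpace m) x}
    (hu : ContDiffAt ℝ 2 (fun z => (u (φ.symm z) : ℂ)) (φ x)) :
    ddbar φ u x v = levi (coordsOfVec φ x v) (fun z => (u (φ.symm z) : ℂ)) (φ x) :=
  (levi_eq_sum hu).symm

omit [ChartedSpace (CSpace n) N] in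
lemma mapD2_eq_fderiv (i : Fin n) (a : Fin m) (v : TangentSpace 𝓘(ℂ, CSpace m) x₀) :
    mapD2 f φ ψ x₀ i a v = fderiv ℂ (mapD f φ ψ i a) (φ x₀) (coordsOfVec φ x₀ v) := by
  conv_rhs => rw [← sum_smul_stdVec (coordsOfVec φ x₀ v), map_sum]
  simp only [mapD2, map_smul, smul_eq_mul]
  exact Finset.sum_congr rfl fun c _ => mul_comm _ _

omit [ChartedSpace (CSpace m) M] in
lemma pullbackCoeff_symm {z : CSpace m} (hz : z ∈ φ.target) (a b : Fin m) :
    pullbackCoeff h f φ ψ (φ.symm z) a b = ∑ i, ∑ j, mapD f φ ψ i a z * conj (mapD f φ ψ j b z) *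
      h.coeff ψ (ψ (f (φ.symm z))) i j := by
  simp only [pullbackCoeff, Matrix.of_apply, φ.right_inv hz]

namespace IsAdapted

variable [IsManifold 𝓘(ℂ, CSpace m) ω M] [IsManifold 𝓘(ℂ, CSpace n) ω N]
  (had : IsAdapted g h f x₀ φ ψ lam) (hf : ContMDiff 𝓘(ℂ, CSpace m) 𝓘(ℂ, CSpace n) ω f)

include had

omit [IsManifold 𝓘(ℂ, CSpace m) ω M] [IsManifold 𝓘(ℂ, CSpace n) ω N] in
lemma symm_zero : φ.symm 0 = x₀ := by
  rw [← had.normal_left.centered, φ.left_inv had.normal_left.mem_source]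

omit [IsManifold 𝓘(ℂ, CSpace m) ω M] [IsManifold 𝓘(ℂ, CSpace n) ω N] in
lemma eventually_mem_target : ∀ᶠ z in nhds (0 : CSpace m), z ∈ φ.target :=
  φ.open_target.mem_nhds had.normal_left.zero_mem_target

include hf

lemma contDiffAt_coordMap : ContDiffAt ℂ ω (fun y => ψ (f (φ.symm y))) 0 := by
  have := _root_.contDiffAt_coordMap hf had.normal_left.holChart had.normal_right.holChart
    had.normal_left.mem_source had.normal_right.mem_source
  rwa [had.normal_left.centered] at this

lemma fderiv_coordMap (v : TangentSpace 𝓘(ℂ, CSpace m) x₀) :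
    fderiv ℂ (fun y => ψ (f (φ.symm y))) 0 (coordsOfVec φ x₀ v) =
      coordsOfVec ψ (f x₀) (mfderiv 𝓘(ℂ, CSpace m) 𝓘(ℂ, CSpace n) f x₀ v) := by
  have := _root_.fderiv_coordMap hf had.normal_left.holChart had.normal_right.holChart
    had.normal_left.mem_source had.normal_right.mem_source v
  rwa [had.normal_left.centered] at this

lemma contDiffAt_mapD (i : Fin n) (a : Fin m) : ContDiffAt ℂ 2 (mapD f φ ψ i a) 0 := by
  have h1 : ContDiffAt ℂ 2 (fderiv ℂ fun y => ψ (f (φ.symm y))) 0 :=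
    ((had.contDiffAt_coordMap hf).fderiv_right (m := ω) (by simp)).of_le le_top
  have h2 : ContDiffAt ℂ 2 (fun z => fderiv ℂ (fun y => ψ (f (φ.symm y))) z (stdVec a)) 0 :=
    h1.clm_apply contDiffAt_const
  exact contDiffAt_piLp 2 |>.1 h2 i

lemma mapD_zero (i : Fin n) (a : Fin m) :
    mapD f φ ψ i a 0 = if (i : ℕ) = a then lam a else 0 := by
  have h1 : coordsOfVec φ x₀ (coordVec φ x₀ a) = stdVec a := by
    rw [coordsOfVec_coordVec had.normal_left.holChart had.normal_left.mem_source, dif_pos a.2]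
  have h2 : coordsOfVec ψ (f x₀) (lam a • coordVec ψ (f x₀) a) =
      lam a • coordsOfVec ψ (f x₀) (coordVec ψ (f x₀) a) :=
    map_smul (mfderiv 𝓘(ℂ, CSpace n) 𝓘(ℂ, CSpace n) ψ (f x₀)) _ _
  rw [mapD, ← h1, had.fderiv_coordMap hf, had.diag, h2,
    coordsOfVec_coordVec had.normal_right.holChart had.normal_right.mem_source]
  by_cases han : (a : ℕ) < n
  · simp [han, stdVec, Fin.ext_iff]
  · have : (i : ℕ) ≠ a := fun hi => han (hi ▸ i.2)
    simp [han, this]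

lemma contDiffAt_coeff_comp (i j : Fin n) :
    ContDiffAt ℝ 2 (fun y => h.coeff ψ (ψ (f (φ.symm y))) i j) 0 := by
  have h0 : ψ (f (φ.symm 0)) = 0 := by rw [had.symm_zero, had.normal_right.centered]
  have h1 : ContDiffAt ℝ 2 (fun y => h.coeff ψ y i j) (ψ (f (φ.symm 0))) := by
    rw [h0]; exact had.normal_right.contDiffAt_coeff_two i j
  exact h1.comp (0 : CSpace m) (((had.contDiffAt_coordMap hf).of_le le_top).restrict_scalars ℝ)

omit [IsManifold 𝓘(ℂ, CSpace m) ω M] [IsManifold 𝓘(ℂ, CSpace n) ω N] hf in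
lemma coeff_comp_zero (i j : Fin n) :
    h.coeff ψ (ψ (f (φ.symm 0))) i j = (1 : Matrix (Fin n) (Fin n) ℂ) i j := by
  rw [had.symm_zero, had.normal_right.centered, had.normal_right.unitary]

lemma fderiv_coeff_comp (i j : Fin n) :
    fderiv ℝ (fun y => h.coeff ψ (ψ (f (φ.symm y))) i j) 0 = 0 := by
  have h0 : ψ (f (φ.symm 0)) = 0 := by rw [had.symm_zero, had.normal_right.centered]
  have h1 : HasFDerivAt (fun y => h.coeff ψ y i j) (0 : CSpace n →L[ℝ] ℂ) (ψ (f (φ.symm 0))) := by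
    rw [h0, ← had.normal_right.first_order i j]
    exact ((had.normal_right.contDiffAt_coeff_two i j).differentiableAt (by norm_num)).hasFDerivAt
  have h2 := (((had.contDiffAt_coordMap hf).differentiableAt (by simp)).restrictScalars ℝ)
  have h3 := (h1.comp (0 : CSpace m) h2.hasFDerivAt).fderiv
  rw [ContinuousLinearMap.zero_comp] at h3
  exact h3

lemma levi_coeff_comp (v : TangentSpace 𝓘(ℂ, CSpace m) x₀) (i j : Fin n) :
    levi (coordsOfVec φ x₀ v) (fun y => h.coeff ψ (ψ (f (φ.symm y))) i j) 0 =
      levi (coordsOfVec ψ (f x₀) (mfderiv 𝓘(ℂ, CSpace m) 𝓘(ℂ, CSpace n) f x₀ v))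
        (fun y => h.coeff ψ y i j) 0 := by
  have h0 : ψ (f (φ.symm 0)) = 0 := by rw [had.symm_zero, had.normal_right.centered]
  have h1 : ContDiffAt ℝ 2 (fun y => h.coeff ψ y i j) (ψ (f (φ.symm 0))) := by
    rw [h0]; exact had.normal_right.contDiffAt_coeff_two i j
  have h2 : fderiv ℝ (fun y => h.coeff ψ y i j) (ψ (f (φ.symm 0))) = 0 := by
    rw [h0]; exact had.normal_right.first_order i j
  have h3 := levi_comp (F := fun y => ψ (f (φ.symm y))) (z := 0) (V := coordsOfVec φ x₀ v) h1 h2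
    ((had.contDiffAt_coordMap hf).of_le le_top)
  rw [h3, had.fderiv_coordMap hf, h0]

omit [IsManifold 𝓘(ℂ, CSpace m) ω M] [IsManifold 𝓘(ℂ, CSpace n) ω N] hf in
lemma pullbackCoeff_eventuallyEq (a b : Fin m) :
    (fun z => pullbackCoeff h f φ ψ (φ.symm z) a b) =ᶠ[nhds 0] fun z =>
      ∑ i, ∑ j, mapD f φ ψ i a z * conj (mapD f φ ψ j b z) *
        h.coeff ψ (ψ (f (φ.symm z))) i j := by
  filter_upwards [had.eventually_mem_target] with z hz using pullbackCoeff_symm hz a b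

lemma contDiffAt_pullbackCoeff (a b : Fin m) :
    ContDiffAt ℝ 2 (fun z => pullbackCoeff h f φ ψ (φ.symm z) a b) 0 :=
  (contDiffAt_pullback (had.contDiffAt_mapD hf) (had.contDiffAt_coeff_comp hf)
    a b).congr_of_eventuallyEq (had.pullbackCoeff_eventuallyEq a b)

lemma pullbackCoeff_zero (a b : Fin m) :
    pullbackCoeff h f φ ψ (φ.symm 0) a b = if a = b then (‖lam a‖ : ℂ) ^ 2 else 0 := by
  rw [(had.pullbackCoeff_eventuallyEq a b).eq_of_nhds]
  simp only [had.coeff_comp_zero, had.mapD_zero hf, Matrix.one_apply, mul_ite, mul_one, mul_zero,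
    Finset.sum_ite_eq, Finset.mem_univ, if_true, ite_mul, zero_mul]
  by_cases hab : a = b
  · subst hab
    rw [Fin.sum_ite_val_eq, if_pos rfl]
    by_cases h1 : (a : ℕ) < n
    · simp [h1, Complex.mul_conj']
    -- For `a` beyond the dimension of `N` the column of `∂f` is empty, and the claimed value
    -- `|lam_a|²` is zero too.
    · simp [h1, had.eq_zero a (not_lt.1 h1)]
  · have hab' : (a : ℕ) ≠ b := fun h' => hab (Fin.ext h')
    rw [Fin.sum_ite_val_eq, if_neg hab]
    simp [hab']

lemma wirt_bar_pullbackCoeff (v : TangentSpace 𝓘(ℂ, CSpace m) x₀) (a b : Fin m) :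
    wirt Complex.I (coordsOfVec φ x₀ v) (fun z => pullbackCoeff h f φ ψ (φ.symm z) a b) 0 =
      if ha : (a : ℕ) < n then lam a * conj (mapD2 f φ ψ x₀ ⟨a, ha⟩ b v) else 0 := by
  rw [(had.pullbackCoeff_eventuallyEq a b).wirt_eq,
    wirt_bar_pullback (had.contDiffAt_mapD hf) (had.contDiffAt_coeff_comp hf)
      (had.fderiv_coeff_comp hf) (had.coeff_comp_zero)]
  simp only [had.mapD_zero hf, ite_mul, zero_mul, Fin.sum_ite_val_eq, mapD2_eq_fderiv,
    had.normal_left.centered]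

lemma wirt_pullbackCoeff (v : TangentSpace 𝓘(ℂ, CSpace m) x₀) (a b : Fin m) :
    wirt (-Complex.I) (coordsOfVec φ x₀ v) (fun z => pullbackCoeff h f φ ψ (φ.symm z) a b) 0 =
      if hb : (b : ℕ) < n then conj (lam b) * mapD2 f φ ψ x₀ ⟨b, hb⟩ a v else 0 := by
  rw [(had.pullbackCoeff_eventuallyEq a b).wirt_eq,
    wirt_pullback (had.contDiffAt_mapD hf) (had.contDiffAt_coeff_comp hf)
      (had.fderiv_coeff_comp hf) (had.coeff_comp_zero)]
  simp only [had.mapD_zero hf, apply_ite conj, map_zero, ite_mul, zero_mul, Fin.sum_ite_val_eq,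
    mapD2_eq_fderiv, had.normal_left.centered, mul_comm (fderiv ℂ _ _ _)]

/-- The two derivatives fall either on `f^i_a` and its conjugate, giving the squares, or both on
`h_{ij̄}`; in the second case diagonality of `∂f` leaves only `i = j = a`, which is a curvature of
`N`. -/
lemma levi_pullbackCoeff (v : TangentSpace 𝓘(ℂ, CSpace m) x₀) (a : Fin m) :
    levi (coordsOfVec φ x₀ v) (fun z => pullbackCoeff h f φ ψ (φ.symm z) a a) 0 =
      ∑ i, (‖mapD2 f φ ψ x₀ i a v‖ : ℂ) ^ 2 - (‖lam a‖ : ℂ) ^ 2 *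
        h.curv ψ (f x₀) (coordVec ψ (f x₀) a) (coordVec ψ (f x₀) a)
          (mfderiv 𝓘(ℂ, CSpace m) 𝓘(ℂ, CSpace n) f x₀ v)
          (mfderiv 𝓘(ℂ, CSpace m) 𝓘(ℂ, CSpace n) f x₀ v) := by
  rw [(had.pullbackCoeff_eventuallyEq a a).levi_eq,
    levi_pullback (had.contDiffAt_mapD hf) (had.contDiffAt_coeff_comp hf)
      (had.fderiv_coeff_comp hf) (had.coeff_comp_zero), had.normal_right.curv_coordVec,
    sub_eq_add_neg]
  simp only [had.levi_coeff_comp hf, had.mapD_zero hf, apply_ite conj, map_zero, mul_ite, mul_zero,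
    ite_mul, zero_mul, Fin.sum_ite_val_eq]
  congr 1
  · simp only [mapD2_eq_fderiv, had.normal_left.centered, Complex.mul_conj']
  · split_ifs with ha
    · rw [Fin.sum_ite_val_eq, dif_pos ha, Complex.mul_conj', mul_neg, neg_neg]
    · simp

end IsAdapted
end Adapted

/-! ### The two Bochner formulas and the signs of their gradient terms. -/

section Bochner

variable {m n : ℕ} {M N : Type*} [TopologicalSpace M] [ChartedSpace (CSpace m) M]
  [TopologicalSpace N] [ChartedSpace (CSpace n) N]
  {g : KaehlerMetric m M} {h : KaehlerMetric n N} {f : M → N} {x₀ : M}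
  {φ : OpenPartialHomeomorph M (CSpace m)} {ψ : OpenPartialHomeomorph N (CSpace n)}
  {lam : Fin m → ℂ} {l : ℕ}

omit [ChartedSpace (CSpace n) N] in
lemma gradW_nonneg (f : M → N) (φ : OpenPartialHomeomorph M (CSpace m))
    (ψ : OpenPartialHomeomorph N (CSpace n)) (lam : Fin m → ℂ) (hl : l ≤ m) (x : M)
    (v : TangentSpace 𝓘(ℂ, CSpace m) x) : 0 ≤ gradW f φ ψ lam hl x v :=
  Finset.sum_nonneg fun a _ => Finset.sum_nonneg fun i _ => by split_ifs <;> positivity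

namespace IsAdapted

variable [IsManifold 𝓘(ℂ, CSpace m) ω M] [IsManifold 𝓘(ℂ, CSpace n) ω N]
  (had : IsAdapted g h f x₀ φ ψ lam) (hf : ContMDiff 𝓘(ℂ, CSpace m) 𝓘(ℂ, CSpace n) ω f)

include had hf

lemma Ufun_eq (hl : l ≤ m) :
    Ufun g h f φ ψ hl x₀ = ∑ a : Fin l, ‖lam (Fin.castLE hl a)‖ ^ 2 := by
  have h1 := ofReal_Ufun g h f φ ψ hl (φ.symm 0)
  simp only [had.pullbackCoeff_zero hf] at h1
  rw [had.symm_zero, had.normal_left.centered, had.normal_left.unitary, inv_one] at h1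
  have h2 : (Ufun g h f φ ψ hl x₀ : ℂ) =
      ((∑ a : Fin l, ‖lam (Fin.castLE hl a)‖ ^ 2 : ℝ) : ℂ) := by
    rw [h1]
    simp [Matrix.one_apply, Fin.castLE_inj]
  exact_mod_cast h2

/-- With `U = ∑ |lam_a|²`, this is the triangle inequality followed by Cauchy-Schwarz for `|lam_a|`
and `|f^a_{av}|`, together with `|f^a_{av}|² ≤ ∑_i |f^i_{av}|²`. -/
lemma gradU_nonneg (hl : l ≤ m) (v : TangentSpace 𝓘(ℂ, CSpace m) x₀) :
    0 ≤ gradU g h f φ ψ lam hl x₀ v := by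
  refine div_nonneg (sub_nonneg.2 ?_) (sq_nonneg _)
  rw [had.Ufun_eq hf]
  set c : Fin l → ℝ := fun a => if ha : (a : ℕ) < n then
    ‖mapD2 f φ ψ x₀ ⟨a, ha⟩ (Fin.castLE hl a) v‖ else 0 with hc
  have h1 : ∀ a, c a ^ 2 ≤ ∑ i : Fin n, ‖mapD2 f φ ψ x₀ i (Fin.castLE hl a) v‖ ^ 2 := by
    intro a
    simp only [hc]
    split_ifs with ha
    · exact Finset.single_le_sum
        (f := fun i : Fin n => ‖mapD2 f φ ψ x₀ i (Fin.castLE hl a) v‖ ^ 2)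
        (fun i _ => sq_nonneg _) (Finset.mem_univ (⟨a, ha⟩ : Fin n))
    · rw [zero_pow two_ne_zero]
      exact Finset.sum_nonneg fun i _ => sq_nonneg _
  rw [Finset.sum_comm]
  refine le_trans ?_ (mul_le_mul_of_nonneg_left (Finset.sum_le_sum fun a _ => h1 a)
    (Finset.sum_nonneg fun a _ => sq_nonneg _))
  refine le_trans ?_ (Finset.sum_mul_sq_le_sq_mul_sq _ _ _)
  refine pow_le_pow_left₀ (norm_nonneg _) ((norm_sum_le _ _).trans
    (Finset.sum_le_sum fun a _ => ?_)) 2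
  simp only [hc]
  split_ifs with ha
  · rw [norm_mul, RCLike.norm_conj]
  · simp

lemma ddbar_log_Ufun (hl : l ≤ m) (v : TangentSpace 𝓘(ℂ, CSpace m) x₀)
    (hU : Ufun g h f φ ψ hl x₀ ≠ 0) :
    ddbar φ (fun x => Real.log (Ufun g h f φ ψ hl x)) x₀ v =
      (gradU g h f φ ψ lam hl x₀ v : ℂ) +
        ∑ a : Fin l, ((‖lam (Fin.castLE hl a)‖ ^ 2 / Ufun g h f φ ψ hl x₀ : ℝ) : ℂ) *
          curvDiff g h f φ ψ x₀ a v := by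
  set V := coordsOfVec φ x₀ v with hV
  set r : CSpace m → ℝ := fun z => Ufun g h f φ ψ hl (φ.symm z) with hr
  have hG := had.normal_left.contDiffAt_coeff_two
  have hdet : (g.coeff φ 0).det ≠ 0 := by simp [had.normal_left.unitary]
  have hI := contDiffAt_matrix_inv hG hdet
  -- First derivatives of `G⁻¹` vanish with those of `G`, so in each product with `A` the two
  -- derivatives fall on the same factor.
  have hI0 : ∀ (s : ℂ) (i j : Fin m), wirt s V (fun y => (g.coeff φ y)⁻¹ i j) 0 = 0 := by
    intro s i j
    have h1 := wirtM_inv (s := s) (V := V) (fun i j => (hG i j).of_le (by norm_num)) hdet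
    have h2 : wirtM s V (g.coeff φ) 0 = 0 := by
      ext i j
      exact wirt_eq_zero (had.normal_left.first_order i j)
    rw [h2, mul_zero, zero_mul, neg_zero] at h1
    exact congrFun (congrFun h1 i) j
  have hA := had.contDiffAt_pullbackCoeff hf
  have hre : (fun z => (r z : ℂ)) =ᶠ[nhds 0] fun z => ∑ a : Fin l, ∑ b : Fin l,
      (g.coeff φ z)⁻¹ (Fin.castLE hl b) (Fin.castLE hl a) *
        pullbackCoeff h f φ ψ (φ.symm z) (Fin.castLE hl a) (Fin.castLE hl b) := by
    filter_upwards [had.eventually_mem_target] with z hz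
    rw [hr, ofReal_Ufun, φ.right_inv hz]
  have hterm : ∀ a b : Fin l, ContDiffAt ℝ 2 (fun z =>
      (g.coeff φ z)⁻¹ (Fin.castLE hl b) (Fin.castLE hl a) *
        pullbackCoeff h f φ ψ (φ.symm z) (Fin.castLE hl a) (Fin.castLE hl b)) 0 := fun a b =>
    (hI _ _).mul (hA _ _)
  have hr2 : ContDiffAt ℝ 2 (fun z => (r z : ℂ)) 0 :=
    (ContDiffAt.sum fun a _ => ContDiffAt.sum fun b _ => hterm a b).congr_of_eventuallyEq hre
  have hr0 : r 0 = Ufun g h f φ ψ hl x₀ := by rw [hr]; simp only [had.symm_zero]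
  have hr0' : r 0 ≠ 0 := hr0 ▸ hU
  set S : ℂ := ∑ a : Fin l, if ha : (a : ℕ) < n then
      conj (lam (Fin.castLE hl a)) * mapD2 f φ ψ x₀ ⟨a, ha⟩ (Fin.castLE hl a) v else 0 with hS
  have hP : wirt (-Complex.I) V (fun z => (r z : ℂ)) 0 = S := by
    rw [hre.wirt_eq, wirt_sum _ fun a _ => DifferentiableAt.fun_sum fun b _ =>
      (hterm a b).differentiableAt (by norm_num)]
    refine Finset.sum_congr rfl fun a _ => ?_
    rw [wirt_sum _ fun b _ => (hterm a b).differentiableAt (by norm_num)]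
    simp only [wirt_mul ((hI _ _).differentiableAt (by norm_num))
      ((hA _ _).differentiableAt (by norm_num)), hI0, zero_mul, zero_add,
      had.normal_left.unitary, inv_one, Matrix.one_apply, Fin.castLE_inj, ite_mul, one_mul,
      Finset.sum_ite_eq', Finset.mem_univ, if_true]
    rw [hV, had.wirt_pullbackCoeff hf]
    rfl
  -- Since `r` is real, `∂̄_V r` is the conjugate of `∂_V r`; their product becomes `|S|²`.
  have hQ : wirt Complex.I V (fun z => (r z : ℂ)) 0 = conj S := by
    rw [← hP, ← Complex.conj_I, ← wirt_conj]
    simp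
  -- The diagonal value of `A` reduces the derivatives of `G⁻¹` to its diagonal entries, with
  -- weights `|lam_a|²`; these give `R^M`, while the Levi form of `A_{aā}` gives the squares and
  -- `-R^N`.
  have hL : levi V (fun z => (r z : ℂ)) 0 =
      ∑ a : Fin l, (∑ i, (‖mapD2 f φ ψ x₀ i (Fin.castLE hl a) v‖ : ℂ) ^ 2 +
        (‖lam (Fin.castLE hl a)‖ : ℂ) ^ 2 * curvDiff g h f φ ψ x₀ a v) := by
    rw [hre.levi_eq, levi_sum _ fun a _ => ContDiffAt.sum fun b _ => hterm a b]
    refine Finset.sum_congr rfl fun a _ => ?_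
    rw [levi_sum _ fun b _ => hterm a b]
    have ham : (a : ℕ) < m := a.2.trans_le hl
    simp only [levi_mul (hI _ _) (hA _ _), hI0, zero_mul, add_zero,
      levi_inv hG had.normal_left.unitary had.normal_left.first_order,
      had.pullbackCoeff_zero hf, had.normal_left.unitary, inv_one, Matrix.one_apply,
      Fin.castLE_inj, ite_mul, mul_ite, one_mul, mul_zero, Finset.sum_add_distrib,
      Finset.sum_ite_eq, Finset.sum_ite_eq', Finset.mem_univ, if_true]
    rw [hV, had.levi_pullbackCoeff hf, curvDiff, had.normal_left.curv_coordVec, dif_pos ham]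
    simp only [Fin.val_castLE]
    have : Fin.castLE hl a = ⟨a, ham⟩ := rfl
    simp only [this]
    ring
  have hdd : ddbar φ (fun x => Real.log (Ufun g h f φ ψ hl x)) x₀ v =
      levi V (fun z => (Real.log (r z) : ℂ)) 0 := by
    rw [← had.normal_left.centered]
    refine ddbar_eq_levi ?_
    rw [had.normal_left.centered]
    exact hr2.ofReal_log hr0'
  rw [hdd, levi_log hr2 hr0', hP, hQ, hL, Complex.mul_conj', gradU, ← hS, ← hr0,
    Finset.sum_add_distrib, Finset.sum_comm]
  have hrc : (r 0 : ℂ) ≠ 0 := by exact_mod_cast hr0'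
  push_cast
  simp only [div_mul_eq_mul_div]
  rw [← Finset.sum_div]
  field_simp
  ring

lemma ddbar_log_Wfun (hl : l ≤ m) (v : TangentSpace 𝓘(ℂ, CSpace m) x₀)
    (hW : Wfun g h f φ ψ hl x₀ ≠ 0) :
    ddbar φ (fun x => Real.log (Wfun g h f φ ψ hl x)) x₀ v =
      (gradW f φ ψ lam hl x₀ v : ℂ) + ∑ a : Fin l, curvDiff g h f φ ψ x₀ a v := by
  set V := coordsOfVec φ x₀ v with hV
  set r : CSpace m → ℝ := fun z => Wfun g h f φ ψ hl (φ.symm z) with hr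
  set B : CSpace m → Matrix (Fin l) (Fin l) ℂ := fun z =>
    (pullbackCoeff h f φ ψ (φ.symm z)).submatrix (Fin.castLE hl) (Fin.castLE hl) with hB
  set C : CSpace m → Matrix (Fin l) (Fin l) ℂ := fun z =>
    (g.coeff φ z).submatrix (Fin.castLE hl) (Fin.castLE hl) with hC
  set d : Fin l → ℂ := fun a => (‖lam (Fin.castLE hl a)‖ : ℂ) ^ 2 with hd
  have hB2 : ∀ i j, ContDiffAt ℝ 2 (fun y => B y i j) 0 := fun i j =>
    had.contDiffAt_pullbackCoeff hf _ _
  have hC2 : ∀ i j, ContDiffAt ℝ 2 (fun y => C y i j) 0 := fun i j =>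
    had.normal_left.contDiffAt_coeff_two _ _
  have hB0 : B 0 = Matrix.diagonal d := by
    ext i j
    simp [hB, hd, had.pullbackCoeff_zero hf, Matrix.diagonal_apply, Fin.castLE_inj]
  have hC0 : C 0 = 1 := by
    ext i j
    simp [hC, had.normal_left.unitary, Matrix.one_apply, Fin.castLE_inj]
  have hre : ∀ᶠ z in nhds 0, (r z : ℂ) = (B z).det / (C z).det := by
    filter_upwards [had.eventually_mem_target] with z hz
    rw [hr, ofReal_Wfun, φ.right_inv hz]
  have hr0 : r 0 = Wfun g h f φ ψ hl x₀ := by rw [hr]; simp only [had.symm_zero]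
  have hr0' : (r 0 : ℂ) ≠ 0 := by rw [hr0]; exact_mod_cast hW
  have hCdet : (C 0).det ≠ 0 := by simp [hC0]
  have hBdet : (B 0).det ≠ 0 := fun h0 => hr0' (by rw [hre.self_of_nhds, h0, zero_div])
  have hd0 : ∀ a, d a ≠ 0 := by
    rw [hB0, Matrix.det_diagonal, Finset.prod_ne_zero_iff] at hBdet
    exact fun a => hBdet a (Finset.mem_univ a)
  -- If `n < l`, the zero-based index `n` lies in the block and `lam` vanishes there, so `det A_ℓ`
  -- would be zero. Hence every `b < l` also indexes a coordinate of `N`.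
  have hln : l ≤ n := by
    by_contra! hnl
    refine hd0 ⟨n, hnl⟩ ?_
    have h0 : lam (Fin.castLE hl ⟨n, hnl⟩) = 0 := had.eq_zero _ le_rfl
    simp only [hd]
    rw [h0]
    simp
  have hBinv : (B 0)⁻¹ = Matrix.diagonal fun a => (d a)⁻¹ := by
    refine Matrix.inv_eq_right_inv ?_
    rw [hB0, Matrix.diagonal_mul_diagonal, ← Matrix.diagonal_one]
    congr 1
    funext a
    exact mul_inv_cancel₀ (hd0 a)
  have hr2 : ContDiffAt ℝ 2 (fun z => (r z : ℂ)) 0 := by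
    have := (contDiffAt_det hB2).mul ((contDiffAt_det hC2).inv hCdet)
    refine this.congr_of_eventuallyEq (hre.mono fun z hz => ?_)
    exact hz.trans (div_eq_mul_inv _ _)
  have hdd : ddbar φ (fun x => Real.log (Wfun g h f φ ψ hl x)) x₀ v =
      levi V (fun z => (Real.log (r z) : ℂ)) 0 := by
    rw [← had.normal_left.centered]
    refine ddbar_eq_levi ?_
    rw [had.normal_left.centered]
    exact hr2.ofReal_log (by exact_mod_cast hr0')
  have hLC : leviLogDet V C 0 = - ∑ a : Fin l,
      g.curv φ x₀ (coordVec φ x₀ a) (coordVec φ x₀ a) v v := by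
    -- The metric block has no quadratic trace, so its `log det` contributes only curvature.
    have h0 : ∀ s, wirtM s V C 0 = 0 := by
      intro s; ext i j
      exact wirt_eq_zero (had.normal_left.first_order _ _)
    rw [leviLogDet, h0, h0, hC0, mul_zero, Matrix.trace_zero, sub_zero, inv_one, one_mul,
      ← Finset.sum_neg_distrib]
    refine Finset.sum_congr rfl fun a _ => ?_
    rw [had.normal_left.curv_coordVec, dif_pos (a.2.trans_le hl), neg_neg]
    rfl
  have hLB : leviLogDet V B 0 = ∑ a : Fin l, (d a)⁻¹ *
        levi V (fun z => pullbackCoeff h f φ ψ (φ.symm z) (Fin.castLE hl a) (Fin.castLE hl a)) 0 -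
      ∑ a : Fin l, ∑ b : Fin l,
        (‖mapD2 f φ ψ x₀ (Fin.castLE hln b) (Fin.castLE hl a) v‖ : ℂ) ^ 2 / d a := by
    rw [leviLogDet, hBinv]
    congr 1
    · simp only [Matrix.trace, Matrix.diag, Matrix.diagonal_mul]
      rfl
    · simp only [Matrix.trace, Matrix.diag]
      refine Finset.sum_congr rfl fun a _ => ?_
      rw [Matrix.mul_apply]
      refine Finset.sum_congr rfl fun b _ => ?_
      have hbn : (b : ℕ) < n := b.2.trans_le hln
      have hPab : wirtM (-Complex.I) V B 0 a b = conj (lam (Fin.castLE hl b)) *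
          mapD2 f φ ψ x₀ (Fin.castLE hln b) (Fin.castLE hl a) v :=
        (had.wirt_pullbackCoeff hf v _ _).trans (dif_pos hbn)
      have hQba : wirtM Complex.I V B 0 b a = lam (Fin.castLE hl b) *
          conj (mapD2 f φ ψ x₀ (Fin.castLE hln b) (Fin.castLE hl a) v) :=
        (had.wirt_bar_pullbackCoeff hf v _ _).trans (dif_pos hbn)
      rw [Matrix.mul_diagonal, Matrix.diagonal_mul, hPab, hQba, ← Complex.mul_conj']
      -- The product of `∂A` and `∂̄A` carries a factor `|lam_b|² = d b`, which cancels the inner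
      -- `B⁻¹`; only the outer `1 / d a` remains.
      have hdb : d b = lam (Fin.castLE hl b) * conj (lam (Fin.castLE hl b)) :=
        (Complex.mul_conj' _).symm
      have h1 := hd0 b
      have h2 := hd0 a
      field_simp
      rw [hdb]
      ring
  -- Splitting the target indices at `l` writes `gradW` as the full sum of squares minus the block
  -- that the quadratic trace in `hLB` subtracts.
  have hgrad : (gradW f φ ψ lam hl x₀ v : ℂ) = ∑ a : Fin l,
      (∑ i, (‖mapD2 f φ ψ x₀ i (Fin.castLE hl a) v‖ : ℂ) ^ 2 / d a -
        ∑ b : Fin l,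
          (‖mapD2 f φ ψ x₀ (Fin.castLE hln b) (Fin.castLE hl a) v‖ : ℂ) ^ 2 / d a) := by
    rw [gradW]
    push_cast
    refine Finset.sum_congr rfl fun a _ => ?_
    rw [Fin.sum_eq_sum_ite_add_sum_castLE hln fun i =>
      (‖mapD2 f φ ψ x₀ i (Fin.castLE hl a) v‖ : ℂ) ^ 2 / d a, add_sub_cancel_right]
    refine Finset.sum_congr rfl fun i _ => ?_
    split_ifs <;> simp [hd]
  rw [hdd, levi_log_det_div hB2 hC2 hBdet hCdet hre, hLB, hLC, hgrad, sub_neg_eq_add,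
    ← Finset.sum_sub_distrib, ← Finset.sum_add_distrib, ← Finset.sum_add_distrib]
  refine Finset.sum_congr rfl fun a _ => ?_
  have h2 := hd0 a
  rw [hV, had.levi_pullbackCoeff hf, curvDiff, mul_sub]
  simp only [Fin.val_castLE, ← Finset.sum_div]
  change _ - (d a)⁻¹ * (d a * _) - _ + _ = _
  rw [inv_mul_cancel_left₀ h2, inv_mul_eq_div]
  -- The weight `d a` before `R^N` has now cancelled against `B⁻¹`, so the curvature terms of `log
  -- W` are unweighted.
  ring

end IsAdapted
end Bochner

end

theorem proposition3p1 {m n : ℕ}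
    {M : Type*} [TopologicalSpace M] [ChartedSpace (CSpace m) M]
    [IsManifold 𝓘(ℂ, CSpace m) ω M]
    {N : Type*} [TopologicalSpace N] [ChartedSpace (CSpace n) N]
    [IsManifold 𝓘(ℂ, CSpace n) ω N]
    (g : KaehlerMetric m M) (h : KaehlerMetric n N)
    (f : M → N) (hf : ContMDiff 𝓘(ℂ, CSpace m) 𝓘(ℂ, CSpace n) ω f)
    (x₀ : M) (φ : OpenPartialHomeomorph M (CSpace m)) (ψ : OpenPartialHomeomorph N (CSpace n))
    (lam : Fin m → ℂ) (hadapted : IsAdapted g h f x₀ φ ψ lam)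
    (l : ℕ) (hl1 : 1 ≤ l) (hl : l ≤ m) (v : TangentSpace 𝓘(ℂ, CSpace m) x₀) :
    (Ufun g h f φ ψ hl x₀ ≠ 0 →
      ddbar φ (fun x => Real.log (Ufun g h f φ ψ hl x)) x₀ v =
          (gradU g h f φ ψ lam hl x₀ v : ℂ) +
            ∑ a : Fin l, ((‖lam (Fin.castLE hl a)‖ ^ 2 / Ufun g h f φ ψ hl x₀ : ℝ) : ℂ) *
              curvDiff g h f φ ψ x₀ a v ∧
      0 ≤ gradU g h f φ ψ lam hl x₀ v) ∧
    (Wfun g h f φ ψ hl x₀ ≠ 0 →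
      ddbar φ (fun x => Real.log (Wfun g h f φ ψ hl x)) x₀ v =
          (gradW f φ ψ lam hl x₀ v : ℂ) +
            ∑ a : Fin l, curvDiff g h f φ ψ x₀ a v ∧
      0 ≤ gradW f φ ψ lam hl x₀ v) :=
  ⟨fun hU => ⟨hadapted.ddbar_log_Ufun hf hl v hU, hadapted.gradU_nonneg hf hl v⟩,
    fun hW => ⟨hadapted.ddbar_log_Wfun hf hl v hW, gradW_nonneg f φ ψ lam hl x₀ v⟩⟩
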